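/- **Setting.** Let $N,T$ be positive integers, $[N]$ the set of actions and $\Delta_N$ the set of probability distributions on $[N]$. For $\mathbf x^1,\dots,\mathbf x^T\in\Delta_N$ and reward vectors $\mathbf u^1,\dots,\mathbf u^T\in[0,1]^N$ the (normalised) swap regret is $$\mathrm{SwapRegret}(\mathbf x^{1:T},\mathbf u^{1:T})=\frac1T\sum_{i\in[N]}\max_{j\in[N]}\sum_{t=1}^T \mathbf x^t[i]\,(\mathbf u^t[j]-\mathbf u^t[i]).$$ Let $S\subseteq[0,1]^N$. A learner against $S$ is a family of maps $\mathbf x^t:S^{t-1}\to\Delta_N$, $t=1,\dots,T$; in round $t$ it plays $\mathbf x^t(\mathbf u^{1:t-1})$. A randomized oblivious adversary on $S$ is a probability distribution $\mathcal D$ on $S^T$, fixed before the game and independently of the learner; $\mathbb E_{\mathcal D}$ denotes expectation over $\mathbf u^{1:T}\sim\mathcal D$. Let $S_N=\{\mathbf u\in[0,1]^N:\|\mathbf u\|_1\le1\}$. **Tree adversary.** For $N\ge2$ and $T\ge 1$ let $D=\lfloor\log_2\min(T,\frac{N+2}4)\rfloor$ and $B=\lfloor T/2^D\rfloor$. Take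 the complete binary tree of depth $D$ with leaves $\ell_1,\dots,\ell_{2^D}$ from left to right, and give each node $v$ two actions $a_v,\dot a_v\in[N]$ of its own. Let $r_v$ ($v$ an internal node) and $s_t$ ($1\le t\le T$) be independent fair $\{0,1\}$-valued coins. The rounds $1,\dots,B2^D$ are divided into $2^D$ consecutive batches of $B$ rounds. In a round $t$ of batch $b$ the rewards are as follows. For each internal node $v$ on the path from the root to $\ell_b$, of depth $d$, one action of $v$ has reward $\frac d{2D}$: it is $\dot a_v$ if $\ell_b$ is a right descendant of $v$ and $r_v=1$, and $a_v$ otherwise. One action of the leaf $\ell_b$ has reward $1$: it is $\dot a_{\ell_b}$ if $s_t=1$, and $a_{\ell_b}$ otherwise. All other rewards are $0$, and all rewards are $0$ in rounds $t>B2^D$. The rescaled tree adversary multiplies all these rewards by $4/(\max(D,1)+3)$. **Theorem.** 1. There is an absolute constant $c>0$ such that for all $N,T\ge2$ the tree adversary is a distribution $\mathcal D$ on $([0,1]^N)^T$ and every learner $(\mathbf x^t)_{t\le T}$ against $[0,1]^N$ satisfies $$\mathbb E_{\mathcal D}\big[\mathrm{SwapRegret}\big((\mathbf x^t(\mathbf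 u^{1:t-1}))_{t\le T},\mathbf u^{1:T}\big)\big]\ \ge\ c\,\min\Big(\frac1{\log^5T},\frac{\sqrt{N/T}}{\log^5N}\Big).$$ 2. There is an absolute constant $c>0$ such that for all $N,T\ge2$ the rescaled tree adversary is a distribution $\mathcal D$ on $S_N^T$ and every learner against $S_N$ satisfies $$\mathbb E_{\mathcal D}\big[\mathrm{SwapRegret}\big((\mathbf x^t(\mathbf u^{1:t-1}))_{t\le T},\mathbf u^{1:T}\big)\big]\ \ge\ c\,\min\Big(\frac1{\log^6T},\frac{\sqrt{N/T}}{\log^6N}\Big).$$ 3. There are absolute constants $c_1,c_2>0$ such that for all $N\ge2$, $\varepsilon\in(0,1)$ and $T\ge1$ with $$T\le c_1\min\Big(\exp\big(c_2\,\varepsilon^{-1/6}\big),\ \frac N{\log^{12}(N)\,\varepsilon^2}\Big)$$ there is a randomized oblivious adversary $\mathcal D$ on $S_N$ such that every learner against $S_N$ has expected swap regret at least $\varepsilon$ over $T$ rounds. (So a learner whose expected swap regret is less than $\varepsilon$ against every such adversary needs more rounds than the right-hand side.) -/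

import Mathlib

noncomputable section

namespace SwapLowerBound

/-- Reward vectors `u ∈ [0,1]^N`. -/
def rewardCube (N : ℕ) : Set (Fin N → ℝ) :=
  {u | ∀ a, u a ∈ Set.Icc (0 : ℝ) 1}

/-- Reward vectors `u ∈ [0,1]^N` with `‖u‖₁ ≤ 1`. -/
def rewardL1Ball (N : ℕ) : Set (Fin N → ℝ) :=
  {u | u ∈ rewardCube N ∧ ∑ a, |u a| ≤ 1}

/-- Swap regret, normalised by the number of rounds `T`, of a sequence `x` of distributions over the
`N` actions against a sequence `u` of reward vectors: every action `i` is replaced by the single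
action `j` that is best in hindsight for the weight put on `i`. -/
def swapRegret {N T : ℕ} (x : Fin T → stdSimplex ℝ (Fin N)) (u : Fin T → Fin N → ℝ) : ℝ :=
  (1 / (T : ℝ)) * ∑ i : Fin N, ⨆ j : Fin N, ∑ t : Fin T, (x t).1 i * (u t j - u t i)

/-- A learner facing reward vectors in `S`: in each round it maps the rewards of all earlier rounds
to a distribution over the actions. -/
def Learner (N T : ℕ) (S : Set (Fin N → ℝ)) : Type :=
  (t : Fin T) → (Fin (t : ℕ) → S) → stdSimplex ℝ (Fin N)

/-- The distributions that a learner plays when the reward vectors are `u`. -/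
def Learner.play {N T : ℕ} {S : Set (Fin N → ℝ)} (x : Learner N T S) (u : Fin T → S) :
    Fin T → stdSimplex ℝ (Fin N) :=
  fun t => x t (fun s => u ⟨s, s.2.trans t.2⟩)

/-- Expected swap regret of the learner `x` when the whole reward sequence is drawn from `𝒟`
independently of the learner (a randomized oblivious adversary). -/
def expectedSwapRegret {N T : ℕ} {S : Set (Fin N → ℝ)} (𝒟 : PMF (Fin T → S))
    (x : Learner N T S) : ℝ :=
  ∑' u : Fin T → S, (𝒟 u).toReal * swapRegret (x.play u) (fun t => (u t : Fin N → ℝ))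

/-- Depth `⌊log₂ (min T ((N + 2) / 4))⌋` of the tree. -/
def treeDepth (N T : ℕ) : ℕ := Nat.log 2 (min T ((N + 2) / 4))

/-- Number of consecutive rounds in each of the `2 ^ treeDepth N T` batches. -/
def batchSize (N T : ℕ) : ℕ := T / 2 ^ treeDepth N T

/-! The nodes of the complete binary tree of depth `D` are numbered `1, …, 2 ^ (D + 1) - 1`: the root
is `1` and the children of `v` are `2 * v` (left) and `2 * v + 1` (right). So `v` has depth
`Nat.log 2 v`, the internal nodes are those with `v < 2 ^ D`, and the leaves, from left to right,
are `2 ^ D + b` for `b < 2 ^ D`. The `b`-th leaf has the ancestor `(2 ^ D + b) / 2 ^ (D - d)` at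
depth `d ≤ D`. Node `v` owns the two actions `2 * (v - 1)` and `2 * (v - 1) + 1`, called the plain and
the dotted action of `v`. -/

/-- `v` lies on the path from the root to the `b`-th leaf. -/
def OnPath (D b v : ℕ) : Prop := (2 ^ D + b) / 2 ^ (D - Nat.log 2 v) = v

/-- The `b`-th leaf lies below the right child of `v`, or is that child. -/
def RightOf (D b v : ℕ) : Prop := (2 ^ D + b) / 2 ^ (D - (Nat.log 2 v + 1)) = 2 * v + 1

/-- Node to which an action belongs. -/
def nodeOf {N : ℕ} (a : Fin N) : ℕ := a / 2 + 1

/-- The action is the dotted one of the two actions of its node. -/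
def IsDotted {N : ℕ} (a : Fin N) : Prop := (a : ℕ) % 2 = 1

/-- The coins of the adversary: one for each internal node (the entry `0` is not used), and one for
each round, used by the leaf of the batch to which that round belongs. -/
abbrev Coins (N T : ℕ) : Type := (Fin (2 ^ treeDepth N T) → Bool) × (Fin T → Bool)

open Classical in
/-- The rewards determined by the coins. In round `t` (counted from `0`) of batch `b = t / B`, the
rewarded actions belong to the nodes on the path to the `b`-th leaf, one action for each node. An
internal node `v` of depth `d` gives reward `d / (2 * D)` to its plain action, except that, if its
coin shows `true`, it switches to its dotted action once the path goes to the right below `v`. The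
leaf gives reward `1` to the action selected by the coin of the round. All other rewards are `0`,
as are all rewards after the last batch. -/
def treeReward (N T : ℕ) (r : Coins N T) : Fin T → Fin N → ℝ := fun t a =>
  let D := treeDepth N T
  let b := (t : ℕ) / batchSize N T
  let v := nodeOf a
  if b < 2 ^ D ∧ OnPath D b v then
    if hv : v < 2 ^ D then
      if IsDotted a ↔ (RightOf D b v ∧ r.1 ⟨v, hv⟩ = true) then
        (Nat.log 2 v : ℝ) / (2 * (D : ℝ))
      else 0
    else
      if IsDotted a ↔ r.2 t = true then 1 else 0
  else 0

/-- The tree adversary: the law of the rewards when all coins are independent and fair. -/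
def treeAdversary (N T : ℕ) : PMF (Fin T → Fin N → ℝ) :=
  (PMF.uniformOfFintype (Coins N T)).map (treeReward N T)

/-- The tree adversary with every reward divided by `(D + 3) / 4`, the `ℓ₁` norm of its
nonzero reward vectors if `D ≥ 1`; for `D = 0` that norm is `1` and nothing is rescaled. -/
def scaledTreeAdversary (N T : ℕ) : PMF (Fin T → Fin N → ℝ) :=
  (treeAdversary N T).map
    (fun u t a => 4 / ((max (treeDepth N T) 1 : ℕ) + 3 : ℝ) * u t a)

end SwapLowerBound

end

noncomputable section

namespace SwapLowerBound

open Finset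

/-! ### Paths in the binary tree -/

/-! Let K(i) be the `actionRegret` of action i: the best gain from moving all weight the learner
puts on i to a single action. Swap regret is the sum of the K(i), divided by T. Two opposite
estimates relate K to the reward that the weights collect; write D for the depth and B for the batch
size.

Upper estimate, internal nodes. An action of a node v of depth d pays d/(2D), while below a child w
of v the actions of w pay 1/(2D) more. Weight left on the action of v below w therefore costs
regret, except that w may switch its paying action halfway. The coin of w is invisible until the
path enters the right subtree of w, so the weight placed before is the same for both outcomes, and
flipping the coin carries the bound from one outcome to the other (`sum_mass_child_le`). The coin of
v itself is used in the same way to treat the two children of v separately. Hence the expected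
reward of an internal action is O(D^4) times its expected regret (`sum_gain_internal_le`).

Upper estimate, leaves. The two actions of a leaf differ by a martingale with symmetric increments.
Its positive part has expectation at least of order 1/√B times its variance, which bounds the reward
of a leaf action by its regret up to a small error (`sum_gain_leaf_le`).

Lower estimate. In every round of a batch one of six fixed actions near the root pays at least
1/(2D), or 1 if D = 0, so any weight with little regret must itself collect such a fraction
(`mass_root_le`).

Together these force swap regret of order 1/(D^5 √B) (`one_le_mul_average_swapRegret`). Rescaling
into the ℓ₁ ball costs one more factor D, and the sizes of D and B give the bounds in N and T. -/

theorem log_two_mul_add_one {v : ℕ} (hv : v ≠ 0) : Nat.log 2 (2 * v + 1) = Nat.log 2 v + 1 := by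
  rw [Nat.log_of_one_lt_of_le (by norm_num) (by omega), show (2 * v + 1) / 2 = v by omega]

theorem log_two_mul {v : ℕ} (hv : v ≠ 0) : Nat.log 2 (2 * v) = Nat.log 2 v + 1 := by
  rw [Nat.log_of_one_lt_of_le (by norm_num) (by omega), show (2 * v) / 2 = v by omega]

theorem log_lt_of_internal {D v : ℕ} (hv : v ≠ 0) (hvD : v < 2 ^ D) : Nat.log 2 v < D :=
  Nat.log_lt_of_lt_pow hv hvD

theorem rightOf_iff {D b v : ℕ} (hv : v ≠ 0) : RightOf D b v ↔ OnPath D b (2 * v + 1) := by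
  rw [RightOf, OnPath, log_two_mul_add_one hv]

/-- Passing to the parent halves the number of a node. -/
theorem onPath_iff_children {D b v : ℕ} (hv : v ≠ 0) (hvD : v < 2 ^ D) :
    OnPath D b v ↔ OnPath D b (2 * v) ∨ OnPath D b (2 * v + 1) := by
  have h := log_lt_of_internal hv hvD
  rw [OnPath, OnPath, OnPath, log_two_mul_add_one hv, log_two_mul hv]
  obtain ⟨k, hk⟩ : ∃ k, D - Nat.log 2 v = k + 1 := ⟨D - Nat.log 2 v - 1, by omega⟩
  rw [show D - (Nat.log 2 v + 1) = k by omega, hk, pow_succ, ← Nat.div_div_eq_div_mul]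
  omega

/-- Leaves are visited from left to right and division is monotone: no leaf below the right child
comes before one below the left child. -/
theorem not_onPath_right_of_onPath_left {D b b' v : ℕ} (hv : v ≠ 0) (hb : b' ≤ b)
    (h : OnPath D b (2 * v)) : ¬ OnPath D b' (2 * v + 1) := by
  intro h'
  rw [OnPath, log_two_mul hv] at h
  rw [OnPath, log_two_mul_add_one hv] at h'
  have := Nat.div_le_div_right (c := 2 ^ (D - (Nat.log 2 v + 1))) (Nat.add_le_add_left hb (2 ^ D))
  omega

theorem log_leaf {D v : ℕ} (h₁ : 2 ^ D ≤ v) (h₂ : v < 2 ^ (D + 1)) : Nat.log 2 v = D :=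
  (Nat.log_eq_iff (by right; exact ⟨by norm_num, by have := Nat.two_pow_pos D; omega⟩)).2 ⟨h₁, h₂⟩

theorem onPath_leaf_iff {D b v : ℕ} (h₁ : 2 ^ D ≤ v) (h₂ : v < 2 ^ (D + 1)) :
    OnPath D b v ↔ 2 ^ D + b = v := by
  rw [OnPath, log_leaf h₁ h₂]; simp

theorem OnPath.lt {D b v : ℕ} (hb : b < 2 ^ D) (h : OnPath D b v) : v < 2 ^ (D + 1) := by
  rw [OnPath] at h
  have := Nat.div_le_self (2 ^ D + b) (2 ^ (D - Nat.log 2 v))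
  rw [pow_succ]; omega

/-! ### Sizes -/

theorem two_pow_treeDepth_le {N T : ℕ} (hN : 2 ≤ N) (hT : 1 ≤ T) :
    2 ^ treeDepth N T ≤ T ∧ 4 * 2 ^ treeDepth N T ≤ N + 2 := by
  have h : 2 ^ treeDepth N T ≤ min T ((N + 2) / 4) := Nat.pow_log_le_self 2 (by omega)
  have h1 := h.trans (min_le_left _ _)
  have h2 := h.trans (min_le_right _ _)
  exact ⟨h1, by omega⟩

theorem batchSize_pos {N T : ℕ} (hN : 2 ≤ N) (hT : 1 ≤ T) : 0 < batchSize N T :=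
  Nat.div_pos (two_pow_treeDepth_le hN hT).1 (Nat.two_pow_pos _)

theorem batchSize_mul_le (N T : ℕ) : batchSize N T * 2 ^ treeDepth N T ≤ T :=
  Nat.div_mul_le_self _ _

/-- Fewer than 2^D rounds are left over and B ≥ 1, so the batches fill at least half of the rounds.
-/
theorem le_two_mul_batchSize_mul {N T : ℕ} (hN : 2 ≤ N) (hT : 1 ≤ T) :
    T ≤ 2 * (batchSize N T * 2 ^ treeDepth N T) := by
  have h := Nat.lt_div_mul_add (a := T) (Nat.two_pow_pos (treeDepth N T))
  have hB := batchSize_pos hN hT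
  have : 2 ^ treeDepth N T ≤ batchSize N T * 2 ^ treeDepth N T := Nat.le_mul_of_pos_left _ hB
  change T < batchSize N T * _ + _ at h
  omega

/-! ### Rewards -/

/-- Round `t` belongs to the batch of a leaf at or below `v`. -/
def InSub (N T v : ℕ) (t : Fin T) : Prop :=
  (t : ℕ) / batchSize N T < 2 ^ treeDepth N T ∧
    OnPath (treeDepth N T) ((t : ℕ) / batchSize N T) v

/-- The coin of the internal node `v` shows `true`. -/
def Switches {N T : ℕ} (r : Coins N T) (v : ℕ) : Prop :=
  ∃ h : v < 2 ^ treeDepth N T, r.1 ⟨v, h⟩ = true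

/-- Reward of an internal node at the depth of `v`. -/
def nodeValue (N T v : ℕ) : ℝ := (Nat.log 2 v : ℝ) / (2 * (treeDepth N T : ℝ))

theorem nodeOf_ne_zero {N : ℕ} (a : Fin N) : nodeOf a ≠ 0 := Nat.succ_ne_zero _

theorem inSub_iff_children {N T v : ℕ} (hv : v ≠ 0) (hvD : v < 2 ^ treeDepth N T) (t : Fin T) :
    InSub N T v t ↔ InSub N T (2 * v) t ∨ InSub N T (2 * v + 1) t := by
  simp only [InSub, onPath_iff_children hv hvD]; tauto

theorem not_inSub_right_of_inSub_left {N T v : ℕ} (hv : v ≠ 0) {t t' : Fin T} (ht : t' ≤ t)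
    (h : InSub N T (2 * v) t) : ¬ InSub N T (2 * v + 1) t' := fun h' =>
  not_onPath_right_of_onPath_left hv (Nat.div_le_div_right ht) h.2 h'.2

open Classical in
theorem treeReward_internal {N T : ℕ} (r : Coins N T) (t : Fin T) (a : Fin N)
    (ha : nodeOf a < 2 ^ treeDepth N T) :
    treeReward N T r t a =
      if InSub N T (nodeOf a) t ∧
        (IsDotted a ↔ InSub N T (2 * nodeOf a + 1) t ∧ Switches r (nodeOf a))
      then nodeValue N T (nodeOf a) else 0 := by
  have h0 := nodeOf_ne_zero a
  have hs : Switches r (nodeOf a) ↔ r.1 ⟨nodeOf a, ha⟩ = true :=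
    ⟨fun ⟨_, h⟩ => h, fun h => ⟨ha, h⟩⟩
  simp only [treeReward, ha, dif_pos, rightOf_iff h0, hs, InSub, nodeValue]
  split_ifs <;> first | rfl | (exfalso; tauto)

open Classical in
theorem treeReward_leaf {N T : ℕ} (r : Coins N T) (t : Fin T) (a : Fin N)
    (ha : 2 ^ treeDepth N T ≤ nodeOf a) :
    treeReward N T r t a =
      if InSub N T (nodeOf a) t ∧ (IsDotted a ↔ r.2 t = true) then 1 else 0 := by
  have hi : ((t : ℕ) / batchSize N T < 2 ^ treeDepth N T ∧
    OnPath (treeDepth N T) ((t : ℕ) / batchSize N T) (nodeOf a)) ↔ InSub N T (nodeOf a) t := Iff.rfl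
  simp only [treeReward, not_lt.2 ha, ↓reduceDIte, hi]
  split_ifs <;> first | rfl | (exfalso; tauto)

theorem nodeValue_nonneg (N T v : ℕ) : 0 ≤ nodeValue N T v := by
  unfold nodeValue; positivity

theorem nodeValue_le_one {N T v : ℕ} (hv : v ≠ 0) (hvD : v < 2 ^ treeDepth N T) :
    nodeValue N T v ≤ 1 := by
  have h := log_lt_of_internal hv hvD
  have h' : (Nat.log 2 v : ℝ) < treeDepth N T := by exact_mod_cast h
  have h0 : (0 : ℝ) ≤ Nat.log 2 v := Nat.cast_nonneg _
  unfold nodeValue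
  rw [div_le_one (by linarith)]; linarith

theorem treeReward_nonneg {N T : ℕ} (r : Coins N T) (t : Fin T) (a : Fin N) :
    0 ≤ treeReward N T r t a := by
  classical
  rcases lt_or_ge (nodeOf a) (2 ^ treeDepth N T) with h | h
  · rw [treeReward_internal r t a h]; split_ifs <;> simp [nodeValue_nonneg]
  · rw [treeReward_leaf r t a h]; split_ifs <;> simp

theorem treeReward_le_one {N T : ℕ} (r : Coins N T) (t : Fin T) (a : Fin N) :
    treeReward N T r t a ≤ 1 := by
  classical
  rcases lt_or_ge (nodeOf a) (2 ^ treeDepth N T) with h | h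
  · rw [treeReward_internal r t a h]
    split_ifs <;> simp [nodeValue_le_one (nodeOf_ne_zero a) h]
  · rw [treeReward_leaf r t a h]; split_ifs <;> simp

/-! ### Flipping coins -/

/-- Flip the coin of the node `v`. -/
def flipNode {N T : ℕ} (v : ℕ) (r : Coins N T) : Coins N T :=
  (fun k => if (k : ℕ) = v then !r.1 k else r.1 k, r.2)

/-- Flip the coin of the round `t`. -/
def flipRound {N T : ℕ} (t : Fin T) (r : Coins N T) : Coins N T :=
  (r.1, fun k => if k = t then !r.2 k else r.2 k)

theorem flipNode_involutive {N T : ℕ} (v : ℕ) :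
    Function.Involutive (flipNode (N := N) (T := T) v) := by
  intro r
  refine Prod.ext (funext fun k => ?_) rfl
  by_cases h : (k : ℕ) = v <;> simp [flipNode, h]

theorem flipRound_involutive {N T : ℕ} (t : Fin T) :
    Function.Involutive (flipRound (N := N) t) := by
  intro r
  refine Prod.ext rfl (funext fun k => ?_)
  by_cases h : k = t <;> simp [flipRound, h]

theorem switches_flipNode_self {N T v : ℕ} (hv : v < 2 ^ treeDepth N T) (r : Coins N T) :
    Switches (flipNode v r) v ↔ ¬ Switches r v := by
  simp [Switches, flipNode, hv]

theorem switches_flipNode_of_ne {N T v w : ℕ} (h : v ≠ w) (r : Coins N T) :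
    Switches (flipNode w r) v ↔ Switches r v := by
  simp [Switches, flipNode, h]

theorem treeReward_flipNode {N T v : ℕ} (r : Coins N T) (t : Fin T)
    (h : ¬ InSub N T (2 * v + 1) t) : treeReward N T (flipNode v r) t = treeReward N T r t := by
  classical
  funext a
  rcases lt_or_ge (nodeOf a) (2 ^ treeDepth N T) with ha | ha
  · rw [treeReward_internal _ t a ha, treeReward_internal _ t a ha]
    by_cases hav : nodeOf a = v
    · simp [hav, h]
    · simp [switches_flipNode_of_ne hav]
  · rw [treeReward_leaf _ t a ha, treeReward_leaf _ t a ha]; rfl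

theorem treeReward_flipRound {N T : ℕ} (r : Coins N T) {t t' : Fin T} (h : t' ≠ t) :
    treeReward N T (flipRound t r) t' = treeReward N T r t' := by
  classical
  funext a
  rcases lt_or_ge (nodeOf a) (2 ^ treeDepth N T) with ha | ha
  · rw [treeReward_internal _ t' a ha, treeReward_internal _ t' a ha]; rfl
  · rw [treeReward_leaf _ t' a ha, treeReward_leaf _ t' a ha]; simp [flipRound, h]

/-- The plays `x` in each round depend on the coins only through the rewards of earlier rounds. -/
def Nonanticipating {N T : ℕ} (x : Coins N T → Fin T → Fin N → ℝ) : Prop :=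
  ∀ r r' t, (∀ t' < t, treeReward N T r t' = treeReward N T r' t') → x r t = x r' t

/-- The coin of `v` shows only in rounds below its right child, all of which come after `t`. -/
theorem Nonanticipating.flipNode {N T v : ℕ} {x : Coins N T → Fin T → Fin N → ℝ}
    (hx : Nonanticipating x) (hv : v ≠ 0) (r : Coins N T) {t : Fin T} (h : InSub N T (2 * v) t) :
    x (flipNode v r) t = x r t :=
  hx _ _ _ fun _ ht' => treeReward_flipNode _ _ (not_inSub_right_of_inSub_left hv ht'.le h)

/-- The coin of round `t` shows only in the rewards of round `t`, which are revealed after the play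
of that round. -/
theorem Nonanticipating.flipRound {N T : ℕ} {x : Coins N T → Fin T → Fin N → ℝ}
    (hx : Nonanticipating x) (r : Coins N T) {t t' : Fin T} (h : t' ≤ t) :
    x (flipRound t r) t' = x r t' :=
  hx _ _ _ fun _ hs => treeReward_flipRound _ (hs.trans_le h).ne

/-! ### Actions of a node -/

/-- Every node of the tree owns a plain and a dotted action. -/
theorem exists_action {N T v : ℕ} (hN : 2 ≤ N) (hT : 1 ≤ T) (hv : v ≠ 0)
    (hvD : v < 2 ^ (treeDepth N T + 1)) (c : Prop) :
    ∃ a : Fin N, nodeOf a = v ∧ (IsDotted a ↔ c) := by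
  have h := (two_pow_treeDepth_le hN hT).2
  rw [pow_succ] at hvD
  by_cases hc : c
  · exact ⟨⟨2 * (v - 1) + 1, by omega⟩, by simp only [nodeOf]; omega,
      by simp only [IsDotted, hc, iff_true]; omega⟩
  · exact ⟨⟨2 * (v - 1), by omega⟩, by simp only [nodeOf]; omega,
      by simp only [IsDotted, hc, iff_false]; omega⟩

theorem nodeOf_inj {N : ℕ} {a b : Fin N} (h : nodeOf a = nodeOf b)
    (h' : IsDotted a ↔ IsDotted b) : a = b := by
  apply Fin.ext
  simp only [nodeOf, IsDotted] at h h'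
  omega

/-! ### Weights along subtrees and gains of actions -/

open Classical in
/-- Total of `y` over the rounds in which the path goes through `v`. -/
def mass (N : ℕ) {T : ℕ} (y : Fin T → ℝ) (v : ℕ) : ℝ := ∑ t, if InSub N T v t then y t else 0

/-- Reward collected by putting the weights `y` on the action `j`. -/
def gain {N T : ℕ} (r : Coins N T) (y : Fin T → ℝ) (j : Fin N) : ℝ :=
  ∑ t, y t * treeReward N T r t j

/-- Regret for the weights `y` put on the action `i`. -/
def actionRegret {N T : ℕ} (r : Coins N T) (y : Fin T → ℝ) (i : Fin N) : ℝ :=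
  ⨆ j, ∑ t, y t * (treeReward N T r t j - treeReward N T r t i)

theorem mass_nonneg (N : ℕ) {T : ℕ} {y : Fin T → ℝ} (hy : ∀ t, 0 ≤ y t) (v : ℕ) :
    0 ≤ mass N y v := by
  classical
  exact sum_nonneg fun t _ => by split_ifs <;> simp [hy]

theorem gain_sub_le_actionRegret {N T : ℕ} (r : Coins N T) (y : Fin T → ℝ) (i j : Fin N) :
    gain r y j - gain r y i ≤ actionRegret r y i := by
  refine le_trans (le_of_eq ?_) (le_ciSup (Set.finite_range _).bddAbove j)
  simp only [gain, mul_sub, sum_sub_distrib]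

theorem actionRegret_nonneg {N T : ℕ} (r : Coins N T) (y : Fin T → ℝ) (i : Fin N) :
    0 ≤ actionRegret r y i := by
  simpa using gain_sub_le_actionRegret r y i i

theorem mass_eq_add {N T v : ℕ} (y : Fin T → ℝ) (hv : v ≠ 0) (hvD : v < 2 ^ treeDepth N T) :
    mass N y v = mass N y (2 * v) + mass N y (2 * v + 1) := by
  classical
  simp only [mass, ← sum_add_distrib]
  refine sum_congr rfl fun t _ => ?_
  have h1 := inSub_iff_children (N := N) hv hvD t
  have h2 := not_inSub_right_of_inSub_left (N := N) hv (le_refl t)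
  by_cases ha : InSub N T (2 * v) t
  · simp [ha, h1, h2 ha]
  · simp [ha, h1]

open Classical in
theorem gain_plain {N T : ℕ} (r : Coins N T) (y : Fin T → ℝ) {a : Fin N}
    (ha : nodeOf a < 2 ^ treeDepth N T) (hd : ¬ IsDotted a) :
    gain r y a = nodeValue N T (nodeOf a) *
      (mass N y (2 * nodeOf a) + if Switches r (nodeOf a) then 0 else mass N y (2 * nodeOf a + 1)) := by
  have h0 := nodeOf_ne_zero a
  have : (if Switches r (nodeOf a) then 0 else mass N y (2 * nodeOf a + 1)) =
      ∑ t, if Switches r (nodeOf a) then 0 else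
        if InSub N T (2 * nodeOf a + 1) t then y t else 0 := by
    split_ifs <;> simp [mass]
  rw [this]
  simp only [gain, mass, ← sum_add_distrib, mul_sum]
  refine sum_congr rfl fun t _ => ?_
  have h1 := inSub_iff_children (N := N) h0 ha t
  have h2 := not_inSub_right_of_inSub_left (N := N) h0 (le_refl t)
  rw [treeReward_internal r t a ha]
  by_cases hl : InSub N T (2 * nodeOf a) t <;> by_cases hr : InSub N T (2 * nodeOf a + 1) t <;>
    by_cases hs : Switches r (nodeOf a) <;> simp_all [mul_comm]

open Classical in
theorem gain_dotted {N T : ℕ} (r : Coins N T) (y : Fin T → ℝ) {a : Fin N}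
    (ha : nodeOf a < 2 ^ treeDepth N T) (hd : IsDotted a) :
    gain r y a = nodeValue N T (nodeOf a) *
      (if Switches r (nodeOf a) then mass N y (2 * nodeOf a + 1) else 0) := by
  have h0 := nodeOf_ne_zero a
  have : (if Switches r (nodeOf a) then mass N y (2 * nodeOf a + 1) else 0) =
      ∑ t, if Switches r (nodeOf a) then
        if InSub N T (2 * nodeOf a + 1) t then y t else 0 else 0 := by
    split_ifs <;> simp [mass]
  rw [this]
  simp only [gain, mul_sum]
  refine sum_congr rfl fun t _ => ?_
  have h1 := inSub_iff_children (N := N) h0 ha t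
  rw [treeReward_internal r t a ha]
  by_cases hr : InSub N T (2 * nodeOf a + 1) t <;>
    by_cases hs : Switches r (nodeOf a) <;> simp_all [mul_comm]

/-- Exactly one of the two actions pays 1 in each round of the leaf; hence one of them collects at
least half of the weight. -/
theorem gain_leaf_add {N T : ℕ} (r : Coins N T) (y : Fin T → ℝ) {a a' : Fin N}
    (ha : 2 ^ treeDepth N T ≤ nodeOf a) (haa : nodeOf a' = nodeOf a)
    (hd : ¬ IsDotted a) (hd' : IsDotted a') :
    gain r y a + gain r y a' = mass N y (nodeOf a) := by
  classical
  simp only [gain, mass, ← sum_add_distrib]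
  refine sum_congr rfl fun t _ => ?_
  rw [treeReward_leaf r t a ha, treeReward_leaf r t a' (haa ▸ ha), haa]
  by_cases hr : InSub N T (nodeOf a) t <;> by_cases hs : r.2 t = true <;> simp [hr, hs, hd, hd']

theorem gain_leaf_le {N T : ℕ} (r : Coins N T) {y : Fin T → ℝ} (hy : ∀ t, 0 ≤ y t) {a : Fin N}
    (ha : 2 ^ treeDepth N T ≤ nodeOf a) : gain r y a ≤ mass N y (nodeOf a) := by
  classical
  refine sum_le_sum fun t _ => ?_
  rw [treeReward_leaf r t a ha]
  have := hy t
  split_ifs <;> first | tauto | simp [this]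

theorem mass_flipNode {N T v : ℕ} {x : Coins N T → Fin T → Fin N → ℝ}
    (hx : Nonanticipating x) (hv : v ≠ 0) (r : Coins N T) (a : Fin N) :
    mass N (fun t => x (flipNode v r) t a) (2 * v) = mass N (fun t => x r t a) (2 * v) := by
  classical
  refine sum_congr rfl fun t _ => ?_
  split_ifs with h
  · exact congrFun (hx.flipNode hv r h) a
  · rfl

/-! ### Regret caused by internal nodes -/

/-- If the action `a` earns at most the reward of `v`, in the rounds through the child `w` of `v` and
for an extra weight `γ`, then moving to an action of `w` bounds its weight below `w`. -/
theorem mass_child_le_of_internal {N T v w : ℕ} (hN : 2 ≤ N) (hT : 1 ≤ T) (hv : v ≠ 0)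
    (hw : w = 2 * v ∨ w = 2 * v + 1) (hwD : w < 2 ^ treeDepth N T)
    {x : Coins N T → Fin T → Fin N → ℝ} (a : Fin N) {γ : ℝ} {r : Coins N T}
    (hown : gain r (fun t => x r t a) a ≤
      nodeValue N T v * (mass N (fun t => x r t a) w + γ)) :
    (¬ Switches r w → mass N (fun t => x r t a) w ≤
      2 * treeDepth N T * actionRegret r (fun t => x r t a) a + Nat.log 2 v * γ) ∧
    (Switches r w → mass N (fun t => x r t a) (2 * w + 1) ≤
      2 * treeDepth N T * actionRegret r (fun t => x r t a) a + Nat.log 2 v * γ +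
        Nat.log 2 v * mass N (fun t => x r t a) (2 * w)) := by
  classical
  have hw0 : w ≠ 0 := by omega
  have hlog : Nat.log 2 w = Nat.log 2 v + 1 := by
    rcases hw with rfl | rfl
    exacts [log_two_mul hv, log_two_mul_add_one hv]
  have hD : (0 : ℝ) < treeDepth N T := by
    exact_mod_cast (Nat.zero_le _).trans_lt (log_lt_of_internal hw0 hwD)
  have hwD' : w < 2 ^ (treeDepth N T + 1) := by rw [pow_succ]; omega
  obtain ⟨p, hpn, hpd⟩ := exists_action hN hT hw0 hwD' False
  obtain ⟨q, hqn, hqd⟩ := exists_action hN hT hw0 hwD' True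
  have hp := gain_sub_le_actionRegret r (fun t => x r t a) a p
  have hq := gain_sub_le_actionRegret r (fun t => x r t a) a q
  rw [gain_plain r _ (by omega) (by simpa using hpd), hpn] at hp
  rw [gain_dotted r _ (by omega) (by simpa using hqd), hqn] at hq
  have hsplit := mass_eq_add (N := N) (fun t => x r t a) hw0 hwD
  set K := actionRegret r (fun t => x r t a) a
  set m := mass N (fun t => x r t a) w
  set m₁ := mass N (fun t => x r t a) (2 * w)
  set m₂ := mass N (fun t => x r t a) (2 * w + 1)
  have hval : nodeValue N T w = nodeValue N T v + 1 / (2 * treeDepth N T) := by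
    simp only [nodeValue, hlog]; push_cast; ring
  have hval' : nodeValue N T v = Nat.log 2 v * (1 / (2 * treeDepth N T)) := by
    simp only [nodeValue]; ring
  rw [hval, hval'] at hp hq
  rw [hval'] at hown
  have hmul : 2 * treeDepth N T * (1 / (2 * (treeDepth N T : ℝ))) = 1 := by field_simp
  -- The gap `e` between the rewards of consecutive depths is what a move from `v` to its child wins
  -- per unit of weight.
  set e := 1 / (2 * (treeDepth N T : ℝ))
  set d : ℝ := Nat.cast (Nat.log 2 v)
  have key : ∀ z : ℝ, e * z ≤ K → z ≤ 2 * treeDepth N T * K := fun z hz => by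
    have := mul_le_mul_of_nonneg_left hz (by positivity : 0 ≤ 2 * (treeDepth N T : ℝ))
    rwa [← mul_assoc, hmul, one_mul] at this
  refine ⟨fun hs => ?_, fun hs => ?_⟩
  · rw [if_neg hs] at hp
    have := key (m - d * γ) (by rw [← hsplit] at hp; linarith)
    linarith
  · rw [if_pos hs] at hq
    have := key (m₂ - d * γ - d * m₁) (by rw [hsplit] at hown; linarith)
    linarith

/-- The two leaf actions pay 1/2 = D/(2D) on average, so a leaf acts like one more level of the tree
and no coin needs to be flipped. -/
theorem mass_child_le_of_leaf {N T v w : ℕ} (hN : 2 ≤ N) (hT : 1 ≤ T) (hv : v ≠ 0)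
    (hvD : v < 2 ^ treeDepth N T)
    (hw : w = 2 * v ∨ w = 2 * v + 1) (hwD : 2 ^ treeDepth N T ≤ w)
    (r : Coins N T) (y : Fin T → ℝ) (a : Fin N) {γ : ℝ}
    (hown : gain r y a ≤ nodeValue N T v * (mass N y w + γ)) :
    mass N y w ≤ 2 * treeDepth N T * actionRegret r y a + Nat.log 2 v * γ := by
  have hw0 : w ≠ 0 := by omega
  have hwD' : w < 2 ^ (treeDepth N T + 1) := by rw [pow_succ]; omega
  have hlog : treeDepth N T = Nat.log 2 v + 1 := by
    rw [← log_leaf hwD hwD']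
    rcases hw with rfl | rfl
    exacts [log_two_mul hv, log_two_mul_add_one hv]
  have hlog' : (treeDepth N T : ℝ) = Nat.log 2 v + 1 := by exact_mod_cast hlog
  have hD : (0 : ℝ) < treeDepth N T := by rw [hlog']; positivity
  obtain ⟨p, hpn, hpd⟩ := exists_action hN hT hw0 hwD' False
  obtain ⟨q, hqn, hqd⟩ := exists_action hN hT hw0 hwD' True
  have hp := gain_sub_le_actionRegret r y a p
  have hq := gain_sub_le_actionRegret r y a q
  have hpq := gain_leaf_add r y (hpn ▸ hwD) (hqn.trans hpn.symm) (by simpa using hpd)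
    (by simpa using hqd)
  rw [hpn] at hpq
  have hval' : nodeValue N T v = Nat.log 2 v * (1 / (2 * treeDepth N T)) := by
    simp only [nodeValue]; ring
  rw [hval'] at hown
  have hmul : 2 * treeDepth N T * (1 / (2 * (treeDepth N T : ℝ))) = 1 := by field_simp
  have h2 := mul_le_mul_of_nonneg_left hown (by positivity : 0 ≤ 2 * (treeDepth N T : ℝ))
  have h3 : 2 * (treeDepth N T : ℝ) * (Nat.log 2 v * (1 / (2 * treeDepth N T)) * (mass N y w + γ))
      = Nat.log 2 v * (mass N y w + γ) := by
    linear_combination (Nat.log 2 v : ℝ) * (mass N y w + γ) * hmul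
  rw [h3] at h2
  have h4 := mul_le_mul_of_nonneg_left (add_le_add hp hq) hD.le
  have h5 : (treeDepth N T : ℝ) * mass N y w = Nat.log 2 v * mass N y w + mass N y w := by
    rw [hlog']; ring
  rw [← hpq] at h5
  nlinarith

/-- Averaged over the coins, the weight that an action receives below a child `w` of `v`, while that
action has at most the reward of `v` there, is bounded by its regret. -/
theorem sum_mass_child_le {N T v w : ℕ} (hN : 2 ≤ N) (hT : 1 ≤ T) (hv : v ≠ 0)
    (hvD : v < 2 ^ treeDepth N T) (hw : w = 2 * v ∨ w = 2 * v + 1)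
    {x : Coins N T → Fin T → Fin N → ℝ} (hx : Nonanticipating x) (hx0 : ∀ r t a, 0 ≤ x r t a)
    (a : Fin N) (G : Coins N T → Prop) [DecidablePred G]
    (hG : ∀ r, G (flipNode w r) ↔ G r) (γ : Coins N T → ℝ) (hγ : ∀ r, 0 ≤ γ r)
    (hown : ∀ r, G r → gain r (fun t => x r t a) a ≤
      nodeValue N T v * (mass N (fun t => x r t a) w + γ r)) :
    ∑ r with G r, mass N (fun t => x r t a) w ≤
      (treeDepth N T + 1) * ∑ r with G r,
        (2 * treeDepth N T * actionRegret r (fun t => x r t a) a + treeDepth N T * γ r) := by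
  classical
  set F : Coins N T → ℝ := fun r =>
    2 * treeDepth N T * actionRegret r (fun t => x r t a) a + Nat.log 2 v * γ r with hF
  have hlog := log_lt_of_internal hv hvD
  have hlog' : (Nat.log 2 v : ℝ) + 1 ≤ treeDepth N T := by exact_mod_cast hlog
  have hF0 : ∀ r, 0 ≤ F r := fun r => by
    have := actionRegret_nonneg r (fun t => x r t a) a
    have := hγ r
    positivity
  have hflip : ∑ r with G r, F (flipNode w r) = ∑ r with G r, F r :=
    sum_bij (fun r _ => flipNode w r) (fun r hr => by simpa [hG] using hr)
      (fun r _ r' _ h => (flipNode_involutive w).injective h)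
      (fun r hr => ⟨flipNode w r, by simpa [hG] using hr, flipNode_involutive w r⟩)
      (fun _ _ => rfl)
  -- If `w` switches, the flipped outcome does not, and the weight below the left child of `w`
  -- agrees in both; so it is at most `F (flipNode w r)`. The bound below the right child contains
  -- that weight once more, multiplied by the depth of `v`.
  have hpt : ∀ r, G r → mass N (fun t => x r t a) w ≤
      F r + (Nat.log 2 v + 1) * F (flipNode w r) := by
    intro r hr
    have hlog0 : (0 : ℝ) ≤ Nat.log 2 v + 1 := by positivity
    rcases lt_or_ge w (2 ^ treeDepth N T) with hwD | hwD
    · have hw0 : w ≠ 0 := by omega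
      have h1 := mass_child_le_of_internal hN hT hv hw hwD a (hown r hr)
      have h2 := mass_child_le_of_internal hN hT hv hw hwD a
        (hown (flipNode w r) ((hG r).2 hr))
      by_cases hs : Switches r w
      · have h3 := h2.1 (by simpa [switches_flipNode_self hwD] using hs)
        have h4 := h1.2 hs
        have h5 : mass N (fun t => x r t a) (2 * w) ≤ F (flipNode w r) := by
          rw [← mass_flipNode hx hw0]
          refine le_trans ?_ h3
          rw [mass_eq_add _ hw0 hwD]
          linarith [mass_nonneg N (fun t => hx0 (flipNode w r) t a) (2 * w + 1)]
        rw [mass_eq_add _ hw0 hwD]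
        have h6 := mul_le_mul_of_nonneg_left h5 (Nat.cast_nonneg (α := ℝ) (Nat.log 2 v))
        simp only [hF] at h5 h6 ⊢
        linarith
      · have := mul_nonneg hlog0 (hF0 (flipNode w r))
        exact (h1.1 hs).trans (by simp only [hF] at this ⊢; linarith)
    · have := mul_nonneg hlog0 (hF0 (flipNode w r))
      exact (mass_child_le_of_leaf hN hT hv hvD hw hwD r _ a (hown r hr)).trans
        (by simp only [hF] at this ⊢; linarith)
  calc ∑ r with G r, mass N (fun t => x r t a) w
      ≤ ∑ r with G r, (F r + (Nat.log 2 v + 1) * F (flipNode w r)) :=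
        sum_le_sum fun r hr => hpt r (by simpa using hr)
    -- `G` ignores the coin of `w`, so both terms have the same sum; the depth of `v` is below D,
    -- whence the factor D + 1.
    _ = (Nat.log 2 v + 1 + 1) * ∑ r with G r, F r := by
        rw [sum_add_distrib, ← mul_sum, hflip]; ring
    _ ≤ (treeDepth N T + 1) * ∑ r with G r, F r :=
        mul_le_mul_of_nonneg_right (by linarith) (sum_nonneg fun r _ => hF0 r)
    _ ≤ _ := by
        refine mul_le_mul_of_nonneg_left (sum_le_sum fun r _ => ?_) (by positivity)
        have := mul_le_mul_of_nonneg_right (by linarith : (Nat.log 2 v : ℝ) ≤ treeDepth N T) (hγ r)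
        simp only [hF]; linarith

theorem sum_filter_comp_flip {Ω : Type*} [Fintype Ω] {φ : Ω → Ω} (hφ : Function.Involutive φ)
    (G G' : Ω → Prop) [DecidablePred G] [DecidablePred G'] (hG : ∀ ω, G (φ ω) ↔ G' ω)
    (f : Ω → ℝ) : ∑ ω with G' ω, f (φ ω) = ∑ ω with G ω, f ω :=
  sum_bij (fun ω _ => φ ω) (fun ω hω => by simpa [hG] using hω)
    (fun _ _ _ _ h => hφ.injective h)
    (fun ω hω => ⟨φ ω, by simpa [← hG, hφ ω] using hω, hφ ω⟩) (fun _ _ => rfl)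

/-- The expected reward of an action of an internal node is bounded by its expected regret. -/
theorem sum_gain_internal_le {N T : ℕ} (hN : 2 ≤ N) (hT : 1 ≤ T)
    {x : Coins N T → Fin T → Fin N → ℝ} (hx : Nonanticipating x) (hx0 : ∀ r t a, 0 ≤ x r t a)
    (a : Fin N) (ha : nodeOf a < 2 ^ treeDepth N T) :
    ∑ r, gain r (fun t => x r t a) a ≤
      28 * (treeDepth N T : ℝ) ^ 4 * ∑ r, actionRegret r (fun t => x r t a) a := by
  classical
  obtain ⟨v, hv⟩ : ∃ v, v = nodeOf a := ⟨_, rfl⟩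
  have hv0 : v ≠ 0 := hv ▸ nodeOf_ne_zero a
  have hvD : v < 2 ^ treeDepth N T := hv ▸ ha
  set K : ℝ := ∑ r, actionRegret r (fun t => x r t a) a with hK
  have hK0 : 0 ≤ K := sum_nonneg fun r _ => actionRegret_nonneg _ _ _
  have hval1 := nodeValue_le_one hv0 hvD
  have hD1 : (1 : ℝ) ≤ treeDepth N T := by
    exact_mod_cast (Nat.zero_le _).trans_lt (log_lt_of_internal hv0 hvD)
  set D : ℝ := Nat.cast (treeDepth N T) with hD
  have hD2 : D ≤ D ^ 2 := by nlinarith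
  have hD3 : D ^ 2 ≤ D ^ 3 := by nlinarith [sq_nonneg D]
  have hD4 : D ^ 3 ≤ D ^ 4 := by nlinarith [pow_pos (by linarith : 0 < D) 3]
  have hfil : ∀ (G : Coins N T → Prop) [DecidablePred G],
      ∑ r with G r, actionRegret r (fun t => x r t a) a ≤ K := fun G _ =>
    sum_le_sum_of_subset_of_nonneg (filter_subset _ _) fun r _ _ => actionRegret_nonneg _ _ _
  have hzero : ∀ (G : Coins N T → Prop) [DecidablePred G],
      (D + 1) * ∑ r with G r, (2 * D * actionRegret r (fun t => x r t a) a + D * 0) ≤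
        4 * D ^ 2 * K := by
    intro G _
    simp only [mul_zero, add_zero, ← mul_sum]
    calc (D + 1) * (2 * D * ∑ r with G r, actionRegret r (fun t => x r t a) a)
        ≤ (D + D) * (2 * D * K) 
            := mul_le_mul (by linarith) (mul_le_mul_of_nonneg_left (hfil G) (by positivity))
              (mul_nonneg (by positivity) (sum_nonneg fun r _ => actionRegret_nonneg _ _ _))
              (by positivity)
      _ = 4 * D ^ 2 * K := by ring
  have hgain : ∀ r, ¬ IsDotted a → gain r (fun t => x r t a) a = nodeValue N T v *
      (mass N (fun t => x r t a) (2 * v) +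
        if Switches r v then 0 else mass N (fun t => x r t a) (2 * v + 1)) := fun r hd => by
    rw [gain_plain r _ ha hd, hv]
  have hgain' : ∀ r, IsDotted a → gain r (fun t => x r t a) a = nodeValue N T v *
      (if Switches r v then mass N (fun t => x r t a) (2 * v + 1) else 0) := fun r hd => by
    rw [gain_dotted r _ ha hd, hv]
  have hm : ∀ r u, 0 ≤ mass N (fun t => x r t a) u := fun r u => mass_nonneg N (fun t => hx0 r t a) u
  by_cases hd : IsDotted a
  · have h := sum_mass_child_le hN hT hv0 hvD (Or.inr rfl) hx hx0 a (fun r => Switches r v)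
      (fun r => switches_flipNode_of_ne (by omega) r) (fun _ => 0) (fun _ => le_rfl)
      (fun r hr => by rw [hgain' r hd, if_pos hr, add_zero])
    calc ∑ r, gain r (fun t => x r t a) a
        ≤ ∑ r, if Switches r v then mass N (fun t => x r t a) (2 * v + 1) else 0 :=
          sum_le_sum fun r _ => by
            rw [hgain' r hd]
            exact mul_le_of_le_one_left (by split_ifs; exacts [hm _ _, le_rfl]) hval1
      _ = ∑ r with Switches r v, mass N (fun t => x r t a) (2 * v + 1) := (sum_filter _ _).symm
      _ ≤ 4 * D ^ 2 * K := h.trans (hzero _)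
      _ ≤ 28 * D ^ 4 * K := by gcongr ?_ * K; linarith
  -- When `v` switches, its plain action pays only below the left child, so no extra weight enters.
  · have h1 := sum_mass_child_le hN hT hv0 hvD (Or.inl rfl) hx hx0 a (fun r => Switches r v)
      (fun r => switches_flipNode_of_ne (by omega) r) (fun _ => 0) (fun _ => le_rfl)
      (fun r hr => by rw [hgain r hd, if_pos hr])
    -- The weight below the left child does not depend on the coin of `v`: the outcomes without a
    -- switch contribute the same amount, which doubles the bound.
    have h2 : ∑ r, mass N (fun t => x r t a) (2 * v) ≤ 8 * D ^ 2 * K := by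
      have hflip := sum_filter_comp_flip (flipNode_involutive (N := N) (T := T) v)
        (fun r => Switches r v) (fun r => ¬ Switches r v)
        (fun r => switches_flipNode_self hvD r) (fun r => mass N (fun t => x r t a) (2 * v))
      simp only [mass_flipNode hx hv0] at hflip
      rw [← sum_filter_add_sum_filter_not univ (fun r => Switches r v), hflip]
      linarith [h1.trans (hzero _)]
    -- Without a switch the action also collects on the left; that weight is the extra `γ`, already
    -- controlled by `h2`.
    have h3 := sum_mass_child_le hN hT hv0 hvD (Or.inr rfl) hx hx0 a (fun r => ¬ Switches r v)
      (fun r => not_congr (switches_flipNode_of_ne (by omega) r))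
      (fun r => mass N (fun t => x r t a) (2 * v)) (fun r => hm _ _)
      (fun r hr => by rw [hgain r hd, if_neg hr, add_comm])
    have h4 : ∑ r with ¬ Switches r v, mass N (fun t => x r t a) (2 * v + 1) ≤ 20 * D ^ 4 * K := by
      refine h3.trans ?_
      rw [sum_add_distrib, ← mul_sum, ← mul_sum]
      calc (D + 1) * (2 * D * ∑ r with ¬ Switches r v, actionRegret r (fun t => x r t a) a +
            D * ∑ r with ¬ Switches r v, mass N (fun t => x r t a) (2 * v))
          ≤ (D + D) * (2 * D * K + D * (8 * D ^ 2 * K)) := by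
            have hl : ∑ r with ¬ Switches r v, mass N (fun t => x r t a) (2 * v) ≤ 8 * D ^ 2 * K :=
              (sum_le_sum_of_subset_of_nonneg (filter_subset _ _) fun r _ _ => hm _ _).trans h2
            have hl0 : 0 ≤ ∑ r with ¬ Switches r v, mass N (fun t => x r t a) (2 * v) :=
              sum_nonneg fun r _ => hm _ _
            have hk0 : 0 ≤ ∑ r with ¬ Switches r v, actionRegret r (fun t => x r t a) a :=
              sum_nonneg fun r _ => actionRegret_nonneg _ _ _
            refine mul_le_mul (by linarith) (add_le_add ?_ ?_) (by positivity) (by positivity)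
            · exact mul_le_mul_of_nonneg_left (hfil _) (by positivity)
            · exact mul_le_mul_of_nonneg_left hl (by positivity)
        _ = (4 * D ^ 2 + 16 * D ^ 4) * K := by ring
        _ ≤ 20 * D ^ 4 * K := by gcongr ?_ * K; linarith
    calc ∑ r, gain r (fun t => x r t a) a
        ≤ ∑ r, (mass N (fun t => x r t a) (2 * v) +
            if ¬ Switches r v then mass N (fun t => x r t a) (2 * v + 1) else 0) :=
          sum_le_sum fun r _ => by
            rw [hgain r hd, ite_not]
            exact mul_le_of_le_one_left
              (add_nonneg (hm _ _) (by split_ifs; exacts [le_rfl, hm _ _])) hval1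
      _ = ∑ r, mass N (fun t => x r t a) (2 * v) +
            ∑ r with ¬ Switches r v, mass N (fun t => x r t a) (2 * v + 1) := by
          rw [sum_add_distrib, sum_filter]
      _ ≤ 8 * D ^ 2 * K + 20 * D ^ 4 * K := add_le_add h2 h4
      _ ≤ 28 * D ^ 4 * K := by nlinarith [mul_le_mul_of_nonneg_right (hD3.trans hD4) hK0]

/-! ### An anticoncentration bound for sums of symmetric increments -/

theorem sum_eq_zero_of_flip {Ω : Type*} [Fintype Ω] {φ : Ω → Ω} (hφ : Function.Involutive φ)
    {f : Ω → ℝ} (hf : ∀ ω, f (φ ω) = -f ω) : ∑ ω, f ω = 0 := by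
  have h : ∑ ω, f (φ ω) = ∑ ω, f ω := Equiv.sum_comp hφ.toPerm f
  simp only [hf, sum_neg_distrib] at h
  linarith

section Martingale

variable {Ω ι : Type*} [Fintype Ω] [LinearOrder ι] {y : ι → Ω → ℝ} {φ : ι → Ω → Ω}

/-- Induction on the largest index: flipping its coin negates the last increment and fixes the
earlier ones, so terms odd in the last increment sum to zero. In the fourth power the surviving y⁴
and 6M²y² are at most y² and 6M². -/
theorem moments_of_symmetric_increments (hφ : ∀ k, Function.Involutive (φ k))
    (hneg : ∀ k ω, y k (φ k ω) = -y k ω) (hfix : ∀ k j ω, j < k → y j (φ k ω) = y j ω)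
    (hy : ∀ k ω, y k ω ^ 2 ≤ 1) (s : Finset ι) :
    ∑ ω, ∑ k ∈ s, y k ω = 0 ∧
    ∑ ω, (∑ k ∈ s, y k ω) ^ 2 = ∑ ω, ∑ k ∈ s, y k ω ^ 2 ∧
    ∑ ω, (∑ k ∈ s, y k ω) ^ 4 ≤ (6 * #s + 1) * ∑ ω, ∑ k ∈ s, y k ω ^ 2 := by
  induction s using Finset.induction_on_max with
  | empty => simp
  | insert a s hs ih =>
    obtain ⟨ih1, ih2, ih4⟩ := ih
    have ha : a ∉ s := fun h => lt_irrefl _ (hs a h)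
    have hM : ∀ ω, ∑ k ∈ s, y k (φ a ω) = ∑ k ∈ s, y k ω := fun ω =>
      sum_congr rfl fun k hk => hfix a k ω (hs k hk)
    have z1 : ∑ ω, y a ω = 0 := sum_eq_zero_of_flip (hφ a) (hneg a)
    have z2 : ∑ ω, (∑ k ∈ s, y k ω) * y a ω = 0 :=
      sum_eq_zero_of_flip (hφ a) fun ω => by rw [hM, hneg]; ring
    have z3 : ∑ ω, (∑ k ∈ s, y k ω) ^ 3 * y a ω = 0 :=
      sum_eq_zero_of_flip (hφ a) fun ω => by rw [hM, hneg]; ring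
    have z4 : ∑ ω, (∑ k ∈ s, y k ω) * y a ω ^ 3 = 0 :=
      sum_eq_zero_of_flip (hφ a) fun ω => by rw [hM, hneg]; ring
    simp only [sum_insert ha, card_insert_of_notMem ha]
    refine ⟨by rw [sum_add_distrib, z1, ih1, add_zero], ?_, ?_⟩
    · have : ∀ ω, (y a ω + ∑ k ∈ s, y k ω) ^ 2 =
          y a ω ^ 2 + 2 * ((∑ k ∈ s, y k ω) * y a ω) + (∑ k ∈ s, y k ω) ^ 2 := fun ω => by ring
      simp only [this, sum_add_distrib, ← mul_sum, z2, ih2]; ring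
    · have hpt : ∀ ω, (y a ω + ∑ k ∈ s, y k ω) ^ 4 ≤
          y a ω ^ 2 + 4 * ((∑ k ∈ s, y k ω) ^ 3 * y a ω) + 4 * ((∑ k ∈ s, y k ω) * y a ω ^ 3) +
            6 * (∑ k ∈ s, y k ω) ^ 2 + (∑ k ∈ s, y k ω) ^ 4 := fun ω => by
        have h1 := mul_le_mul_of_nonneg_left (hy a ω) (sq_nonneg (y a ω))
        have h2 := mul_le_mul_of_nonneg_left (hy a ω) (sq_nonneg (∑ k ∈ s, y k ω))
        nlinarith
      refine (sum_le_sum fun ω _ => hpt ω).trans ?_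
      simp only [sum_add_distrib, ← mul_sum, z3, z4, ih2] at ih4 ⊢
      have h0 : 0 ≤ ∑ ω, y a ω ^ 2 := sum_nonneg fun _ _ => sq_nonneg _
      have h1 : (0 : ℝ) ≤ #s := Nat.cast_nonneg _
      push_cast
      nlinarith [mul_nonneg h1 h0]

/-- The second moment is large and the fourth moment is small, so the absolute value, and by mean
zero the positive part, cannot be small. A pointwise polynomial inequality replaces Hölder's
inequality. -/
theorem le_sum_max_of_symmetric_increments (hφ : ∀ k, Function.Involutive (φ k))
    (hneg : ∀ k ω, y k (φ k ω) = -y k ω) (hfix : ∀ k j ω, j < k → y j (φ k ω) = y j ω)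
    (hy : ∀ k ω, y k ω ^ 2 ≤ 1) (s : Finset ι) {n : ℕ} (hn : 0 < n) (hs : #s ≤ n) :
    ∑ ω, ∑ k ∈ s, y k ω ^ 2 ≤ 8 * Real.sqrt n * ∑ ω, max 0 (∑ k ∈ s, y k ω) := by
  obtain ⟨m1, m2, m4⟩ := moments_of_symmetric_increments hφ hneg hfix hy s
  set V := ∑ ω, ∑ k ∈ s, y k ω ^ 2
  have hV : 0 ≤ V := sum_nonneg fun _ _ => sum_nonneg fun _ _ => sq_nonneg _
  have hn1 : (1 : ℝ) ≤ n := by exact_mod_cast hn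
  have hs' : (#s : ℝ) ≤ n := by exact_mod_cast hs
  have hq : 0 < Real.sqrt n := Real.sqrt_pos.2 (by linarith)
  have hqq : Real.sqrt n ^ 2 = n := Real.sq_sqrt (by linarith)
  set q := Real.sqrt n
  have m4' : ∑ ω, (∑ k ∈ s, y k ω) ^ 4 ≤ 7 * q ^ 2 * V :=
    m4.trans (mul_le_mul_of_nonneg_right (by rw [hqq]; linarith) hV)
  -- As max(0, m) = (m + |m|)/2, this is an inequality in |m| alone; the linear term vanishes after
  -- summation.
  have hpt : ∀ m : ℝ, 16 * q ^ 2 * m + 8 * q * m ^ 2 - m ^ 4 / (2 * q) ≤ 32 * q ^ 2 * max 0 m := by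
    intro m
    have habs : 8 * q * |m| ^ 2 - |m| ^ 4 / (2 * q) ≤ 16 * q ^ 2 * |m| := by
      rw [sub_le_iff_le_add, ← sub_le_iff_le_add', le_div_iff₀ (by positivity)]
      have h0 := abs_nonneg m
      generalize |m| = z at h0
      -- The expression equals z(z³ - 16q²z + 32q³), written so that positivity is visible.
      have : 0 ≤ z * ((z - 7 / 3 * q) ^ 2 * (z + 14 / 3 * q) + 1 / 3 * q ^ 2 * z + 178 / 27 * q ^ 3) := by
        positivity
      nlinarith
    rw [sq_abs, Even.pow_abs ⟨2, rfl⟩] at habs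
    rcases le_total 0 m with h | h
    · rw [max_eq_right h]; rw [abs_of_nonneg h] at habs; linarith
    · rw [max_eq_left h]; rw [abs_of_nonpos h] at habs; linarith
  have hsum := sum_le_sum fun ω (_ : ω ∈ univ) => hpt (∑ k ∈ s, y k ω)
  simp only [sum_sub_distrib, sum_add_distrib, ← mul_sum, ← sum_div, m1, m2] at hsum
  have h5 : (∑ ω, (∑ k ∈ s, y k ω) ^ 4) / (2 * q) ≤ 7 / 2 * q * V := by
    rw [div_le_iff₀ (by positivity)]; linarith
  -- The coefficient left on the side of `V` is 8 - 7/2 ≥ 4, and 32/4 = 8.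
  have h6 : q * V ≤ q * (8 * q * ∑ ω, max 0 (∑ k ∈ s, y k ω)) := by nlinarith
  exact le_of_mul_le_mul_left h6 hq

end Martingale

/-! ### Regret caused by leaves -/

theorem inSub_leaf_iff {N T v : ℕ} (h₁ : 2 ^ treeDepth N T ≤ v) (t : Fin T) :
    InSub N T v t ↔ (t : ℕ) / batchSize N T < 2 ^ treeDepth N T ∧
      2 ^ treeDepth N T + (t : ℕ) / batchSize N T = v := by
  refine ⟨fun h => ⟨h.1, (onPath_leaf_iff h₁ (h.2.lt h.1)).1 h.2⟩, fun h => ⟨h.1, ?_⟩⟩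
  refine (onPath_leaf_iff h₁ ?_).2 h.2
  rw [pow_succ]; omega

open Classical in
theorem card_inSub_leaf_le {N T v : ℕ} (hN : 2 ≤ N) (hT : 1 ≤ T) (h₁ : 2 ^ treeDepth N T ≤ v) :
    #{t : Fin T | InSub N T v t} ≤ batchSize N T := by
  have hB := batchSize_pos hN hT
  obtain ⟨B, hBdef⟩ : ∃ B, B = batchSize N T := ⟨_, rfl⟩
  rw [← hBdef] at hB ⊢
  obtain ⟨b, hb⟩ : ∃ b, b = v - 2 ^ treeDepth N T := ⟨_, rfl⟩
  calc #{t : Fin T | InSub N T v t} ≤ #(Ico (b * B) (b * B + B)) := by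
        refine card_le_card_of_injOn (fun t => (t : ℕ)) (fun t ht => ?_) (fun _ _ _ _ h => Fin.ext h)
        have h := (inSub_leaf_iff h₁ t).1 (by simpa using ht)
        rw [← hBdef] at h
        have hd : (t : ℕ) / B = b := by omega
        have h1 := Nat.div_mul_le_self (t : ℕ) B
        have h2 := Nat.lt_div_mul_add (a := (t : ℕ)) hB
        rw [hd] at h1 h2
        simpa using ⟨h1, h2⟩
    _ = B := by simp

/-- Moving to the other action of the leaf wins a martingale whose variance is the sum of the
squared weights. The parameter `θ` turns squares into weights: weights well below `θ` are charged to
the error term. -/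
theorem sum_gain_leaf_le {N T : ℕ} (hN : 2 ≤ N) (hT : 1 ≤ T)
    {x : Coins N T → Fin T → Fin N → ℝ} (hx : Nonanticipating x) (hx0 : ∀ r t a, 0 ≤ x r t a)
    (hx1 : ∀ r t a, x r t a ≤ 1) (a : Fin N) (ha : 2 ^ treeDepth N T ≤ nodeOf a)
    (ha' : nodeOf a < 2 ^ (treeDepth N T + 1)) {θ : ℝ} (hθ : 0 < θ) :
    ∑ r, gain r (fun t => x r t a) a ≤
      4 * Real.sqrt (batchSize N T) / θ * ∑ r, actionRegret r (fun t => x r t a) a +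
        θ / 2 * batchSize N T * Fintype.card (Coins N T) := by
  classical
  set s : Finset (Fin T) := {t : Fin T | InSub N T (nodeOf a) t} with hs
  have hcard : #s ≤ batchSize N T := card_inSub_leaf_le hN hT ha
  set σ : Fin T → Coins N T → ℝ := fun t r => if IsDotted a ↔ r.2 t = true then -1 else 1 with hσ
  have hσ2 : ∀ t r, σ t r ^ 2 = 1 := fun t r => by simp only [hσ]; split_ifs <;> norm_num
  obtain ⟨j, hjn, hjd⟩ := exists_action hN hT (nodeOf_ne_zero a) ha' (¬ IsDotted a)
  have hgain : ∀ r, gain r (fun t => x r t a) j - gain r (fun t => x r t a) a =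
      ∑ t ∈ s, x r t a * σ t r := fun r => by
    simp only [gain, hs, sum_filter, ← sum_sub_distrib]
    refine sum_congr rfl fun t _ => ?_
    rw [treeReward_leaf r t a ha, treeReward_leaf r t j (hjn ▸ ha), hjn, hjd]
    by_cases h : InSub N T (nodeOf a) t <;> by_cases h' : IsDotted a <;>
      by_cases h'' : r.2 t = true <;> simp [hσ, h, h', h'']
  have hmain := le_sum_max_of_symmetric_increments (y := fun t r => x r t a * σ t r)
    (φ := flipRound) flipRound_involutive
    (fun t r => by
      have : σ t (flipRound t r) = -σ t r := by
        by_cases h' : IsDotted a <;> by_cases h'' : r.2 t = true <;>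
          simp [hσ, flipRound, h', h'']
      rw [this, hx.flipRound r le_rfl]; ring)
    (fun t t' r htt => by
      have : σ t' (flipRound t r) = σ t' r := by simp [hσ, flipRound, htt.ne]
      rw [this, hx.flipRound r htt.le])
    (fun t r => by
      rw [mul_pow, hσ2, mul_one]
      exact pow_le_one₀ (hx0 _ _ _) (hx1 _ _ _))
    s (batchSize_pos hN hT) hcard
  simp only [mul_pow, hσ2, mul_one] at hmain
  have hK : ∑ r, max 0 (∑ t ∈ s, x r t a * σ t r) ≤
      ∑ r, actionRegret r (fun t => x r t a) a := sum_le_sum fun r _ =>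
    max_le (actionRegret_nonneg _ _ _) (hgain r ▸ gain_sub_le_actionRegret _ _ _ _)
  have hlin : ∀ r, gain r (fun t => x r t a) a ≤
      1 / (2 * θ) * (∑ t ∈ s, x r t a ^ 2) + θ / 2 * batchSize N T := fun r => by
    refine (gain_leaf_le r (fun t => hx0 r t a) ha).trans ?_
    have h1 : mass N (fun t => x r t a) (nodeOf a) = ∑ t ∈ s, x r t a := by
      rw [hs, sum_filter]; rfl
    -- This is (z - θ)² ≥ 0.
    have h2 : ∀ z : ℝ, z ≤ 1 / (2 * θ) * z ^ 2 + θ / 2 := fun z => by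
      have : 1 / (2 * θ) * z ^ 2 + θ / 2 - z = (z - θ) ^ 2 / (2 * θ) := by field_simp; ring
      have h3 : 0 ≤ (z - θ) ^ 2 / (2 * θ) := by positivity
      linarith
    rw [h1]
    refine (sum_le_sum fun t _ => h2 (x r t a)).trans ?_
    rw [sum_add_distrib, ← mul_sum, sum_const, nsmul_eq_mul, mul_comm (#s : ℝ)]
    gcongr
  calc ∑ r, gain r (fun t => x r t a) a
      ≤ ∑ r, (1 / (2 * θ) * (∑ t ∈ s, x r t a ^ 2) + θ / 2 * batchSize N T) :=
        sum_le_sum fun r _ => hlin r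
    _ = 1 / (2 * θ) * ∑ r, ∑ t ∈ s, x r t a ^ 2 +
          θ / 2 * batchSize N T * Fintype.card (Coins N T) := by
        rw [sum_add_distrib, ← mul_sum, sum_const, card_univ, nsmul_eq_mul]; ring
    _ ≤ 1 / (2 * θ) * (8 * Real.sqrt (batchSize N T) *
          ∑ r, actionRegret r (fun t => x r t a) a) +
          θ / 2 * batchSize N T * Fintype.card (Coins N T) := by
        have := hmain.trans (mul_le_mul_of_nonneg_left hK (by positivity))
        gcongr
    _ = _ := by field_simp; ring

/-! ### Combining the actions -/

theorem exists_rewarded_action {N T w : ℕ} (hN : 2 ≤ N) (hT : 1 ≤ T) (hw : w ≠ 0)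
    (r : Coins N T) (t : Fin T) (h : InSub N T w t) :
    ∃ a : Fin N, nodeOf a = w ∧
      treeReward N T r t a = if w < 2 ^ treeDepth N T then nodeValue N T w else 1 := by
  classical
  have hwD := h.2.lt h.1
  by_cases hi : w < 2 ^ treeDepth N T
  · obtain ⟨a, rfl, had⟩ := exists_action hN hT hw hwD (InSub N T (2 * w + 1) t ∧ Switches r w)
    exact ⟨a, rfl, by rw [treeReward_internal r t a hi, if_pos ⟨h, had⟩, if_pos hi]⟩
  · obtain ⟨a, rfl, had⟩ := exists_action hN hT hw hwD (r.2 t = true)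
    exact ⟨a, rfl, by rw [treeReward_leaf r t a (not_lt.1 hi), if_pos ⟨h, had⟩, if_neg hi]⟩

/-- The depth of the tree, but at least `1`. -/
def depthPos (N T : ℕ) : ℕ := max (treeDepth N T) 1

theorem one_le_depthPos (N T : ℕ) : (1 : ℝ) ≤ depthPos N T := by
  exact_mod_cast le_max_right _ _

/-- The root pays 0 when it is internal, so a child of the root is used; the nodes 1, 2, 3 own the
actions 0 to 5. For D = 0 the root is the leaf and pays 1. -/
theorem exists_rewarded_small_action {N T : ℕ} (hN : 2 ≤ N) (hT : 1 ≤ T)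
    (r : Coins N T) (t : Fin T) (h : InSub N T 1 t) :
    ∃ a : Fin N, (a : ℕ) < 6 ∧ 1 / (2 * (depthPos N T : ℝ)) ≤ treeReward N T r t a := by
  have hD1 := one_le_depthPos N T
  have hle : 1 / (2 * (depthPos N T : ℝ)) ≤ 1 := by
    rw [div_le_one (by positivity)]; linarith
  obtain ⟨w, hw, hw3, hwt, hwv⟩ : ∃ w : ℕ, w ≠ 0 ∧ w ≤ 3 ∧ InSub N T w t ∧
      (w < 2 ^ treeDepth N T → Nat.log 2 w = 1) := by
    rcases Nat.eq_zero_or_pos (treeDepth N T) with h0 | h0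
    · exact ⟨1, by norm_num, by norm_num, h, fun h1 => by rw [h0] at h1; norm_num at h1⟩
    · rcases (inSub_iff_children one_ne_zero (Nat.one_lt_two_pow h0.ne') t).1 h with h' | h'
      · exact ⟨2 * 1, by norm_num, by norm_num, h', fun _ => by
          rw [log_two_mul one_ne_zero]; simp⟩
      · exact ⟨2 * 1 + 1, by norm_num, by norm_num, h', fun _ => by
          rw [log_two_mul_add_one one_ne_zero]; simp⟩
  obtain ⟨a, haw, har⟩ := exists_rewarded_action hN hT hw r t hwt
  refine ⟨a, by unfold nodeOf at haw; omega, ?_⟩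
  rw [har]
  split_ifs with hi
  · have hD : 0 < treeDepth N T := by have := log_lt_of_internal hw hi; omega
    rw [nodeValue, hwv hi, depthPos, max_eq_left hD]; simp
  · exact hle

/-- Together the six actions near the root collect at least 1/(2D) per unit of weight (for D ≥ 1),
and none of them collects more than `i` by more than the regret of `i`. -/
theorem mass_root_le {N T : ℕ} (hN : 2 ≤ N) (hT : 1 ≤ T) (r : Coins N T) {y : Fin T → ℝ}
    (hy : ∀ t, 0 ≤ y t) (i : Fin N) :
    1 / (2 * (depthPos N T : ℝ)) * mass N y 1 ≤ 6 * actionRegret r y i + 6 * gain r y i := by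
  classical
  set J : Finset (Fin N) := {j : Fin N | (j : ℕ) < 6} with hJ
  have hcard : (#J : ℝ) ≤ 6 := by
    have : #J ≤ #(range 6) := card_le_card_of_injOn (fun j => (j : ℕ))
      (fun j hj => by simpa [hJ] using hj) (fun _ _ _ _ h => Fin.ext h)
    exact_mod_cast this.trans (by simp)
  have hg : 0 ≤ gain r y i := sum_nonneg fun t _ => mul_nonneg (hy t) (treeReward_nonneg _ _ _)
  have hsum : ∑ j ∈ J, gain r y j ≤ #J * (actionRegret r y i + gain r y i) := by
    rw [← nsmul_eq_mul]
    exact sum_le_card_nsmul _ _ _ fun j _ => by linarith [gain_sub_le_actionRegret r y i j]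
  have hmass : 1 / (2 * (depthPos N T : ℝ)) * mass N y 1 ≤ ∑ j ∈ J, gain r y j := by
    simp only [gain, mass]
    rw [sum_comm, mul_sum]
    refine sum_le_sum fun t _ => ?_
    rw [← mul_sum]
    have hnn : 0 ≤ ∑ j ∈ J, treeReward N T r t j := sum_nonneg fun j _ => treeReward_nonneg _ _ _
    split_ifs with h
    · obtain ⟨a, ha6, har⟩ := exists_rewarded_small_action hN hT r t h
      have := single_le_sum (f := fun j => treeReward N T r t j)
        (fun j _ => treeReward_nonneg r t j) (show a ∈ J by simpa [hJ] using ha6)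
      rw [mul_comm]
      exact mul_le_mul_of_nonneg_left (har.trans this) (hy t)
    · rw [mul_zero]; exact mul_nonneg (hy t) hnn
  have := mul_le_mul_of_nonneg_right hcard (add_nonneg (actionRegret_nonneg r y i) hg)
  linarith

theorem inSub_one_iff {N T : ℕ} (t : Fin T) :
    InSub N T 1 t ↔ (t : ℕ) / batchSize N T < 2 ^ treeDepth N T := by
  refine ⟨fun h => h.1, fun h => ⟨h, ?_⟩⟩
  rw [OnPath, Nat.log_one_right, Nat.sub_zero, Nat.add_div_left _ (Nat.two_pow_pos _),
    Nat.div_eq_of_lt h]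

theorem le_sum_mass_root {N T : ℕ} (hN : 2 ≤ N) (hT : 1 ≤ T) {x : Fin T → Fin N → ℝ}
    (hx : ∀ t, ∑ i, x t i = 1) :
    ((batchSize N T * 2 ^ treeDepth N T : ℕ) : ℝ) ≤ ∑ i, mass N (fun t => x t i) 1 := by
  classical
  have h1 : ∑ i, mass N (fun t => x t i) 1 = #{t : Fin T | InSub N T 1 t} := by
    simp only [mass]
    rw [sum_comm, card_filter, Nat.cast_sum]
    refine sum_congr rfl fun t _ => ?_
    split_ifs <;> simp [hx]
  have hle := batchSize_mul_le N T
  have hB := batchSize_pos hN hT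
  rw [h1]
  have h2 : #(univ : Finset (Fin (batchSize N T * 2 ^ treeDepth N T))) ≤
      #{t : Fin T | InSub N T 1 t} :=
    card_le_card_of_injOn (Fin.castLE hle) (fun k _ => by
      simp only [coe_filter, Finset.mem_univ, true_and, Set.mem_ofPred_eq, inSub_one_iff]
      exact Nat.div_lt_of_lt_mul k.2) ((Fin.castLE_injective hle).injOn)
  rw [card_univ, Fintype.card_fin] at h2
  exact_mod_cast h2

theorem card_leaf_actions_le (D N : ℕ) :
    #{a : Fin N | 2 ^ D ≤ nodeOf a ∧ nodeOf a < 2 ^ (D + 1)} ≤ 2 * 2 ^ D := by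
  calc _ ≤ #(Ico (2 * 2 ^ D) (2 * 2 ^ D + 2 * 2 ^ D)) := by
        -- The shift by 2 is used because `nodeOf a` equals (a + 2) / 2.
        refine card_le_card_of_injOn (fun a => (a : ℕ) + 2) (fun a ha => ?_)
          (fun a _ b _ h => Fin.ext (by simpa using h))
        simp only [coe_filter, Finset.mem_univ, true_and, Set.mem_ofPred_eq, nodeOf, pow_succ] at ha
        simp only [coe_Ico, Set.mem_Ico]
        omega
    _ = _ := by simp

theorem gain_eq_zero_of_large {N T : ℕ} (r : Coins N T) (y : Fin T → ℝ) {a : Fin N}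
    (ha : 2 ^ (treeDepth N T + 1) ≤ nodeOf a) : gain r y a = 0 := by
  classical
  refine sum_eq_zero fun t _ => ?_
  have h : ¬ InSub N T (nodeOf a) t := fun h => absurd (h.2.lt h.1) (not_lt.2 ha)
  rw [treeReward_leaf r t a (by rw [pow_succ] at ha; omega), if_neg fun h' => h h'.1, mul_zero]

/-- Only the at most 2 · 2^D leaf actions carry the error θB/2, which adds up to θ times the number
of rounds in batches. -/
theorem sum_sum_gain_le {N T : ℕ} (hN : 2 ≤ N) (hT : 1 ≤ T)
    {x : Coins N T → Fin T → Fin N → ℝ} (hx : Nonanticipating x) (hx0 : ∀ r t a, 0 ≤ x r t a)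
    (hx1 : ∀ r t a, x r t a ≤ 1) {θ : ℝ} (hθ : 0 < θ) :
    ∑ i, ∑ r, gain r (fun t => x r t i) i ≤
      (28 * (depthPos N T : ℝ) ^ 4 + 4 * Real.sqrt (batchSize N T) / θ) *
        ∑ i, ∑ r, actionRegret r (fun t => x r t i) i +
      θ * (batchSize N T * 2 ^ treeDepth N T : ℕ) * Fintype.card (Coins N T) := by
  classical
  set D := treeDepth N T with hD
  set L : Finset (Fin N) := {a : Fin N | 2 ^ D ≤ nodeOf a ∧ nodeOf a < 2 ^ (D + 1)} with hL
  have hDD : (D : ℝ) ≤ depthPos N T := by exact_mod_cast le_max_left _ _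
  set c : ℝ := 28 * (depthPos N T : ℝ) ^ 4 + 4 * Real.sqrt (batchSize N T) / θ with hc
  set e : ℝ := θ / 2 * batchSize N T * Fintype.card (Coins N T) with he
  have hc0 : 0 ≤ 4 * Real.sqrt (batchSize N T) / θ := by positivity
  have hpt : ∀ i, ∑ r, gain r (fun t => x r t i) i ≤
      c * ∑ r, actionRegret r (fun t => x r t i) i + if i ∈ L then e else 0 := by
    intro i
    have hK : 0 ≤ ∑ r, actionRegret r (fun t => x r t i) i :=
      sum_nonneg fun r _ => actionRegret_nonneg _ _ _
    rcases lt_or_ge (nodeOf i) (2 ^ D) with h | h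
    · have hi : i ∉ L := by simp [hL, h]
      rw [if_neg hi, add_zero]
      refine (sum_gain_internal_le hN hT hx hx0 i h).trans ?_
      refine mul_le_mul_of_nonneg_right ?_ hK
      have : (D : ℝ) ^ 4 ≤ (depthPos N T : ℝ) ^ 4 := by gcongr
      rw [hc]; linarith
    · rcases lt_or_ge (nodeOf i) (2 ^ (D + 1)) with h' | h'
      · have hi : i ∈ L := by simp [hL, h, h']
        rw [if_pos hi]
        refine (sum_gain_leaf_le hN hT hx hx0 hx1 i h h' hθ).trans ?_
        refine add_le_add (mul_le_mul_of_nonneg_right ?_ hK) le_rfl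
        have : (0 : ℝ) ≤ (depthPos N T : ℝ) ^ 4 := by positivity
        rw [hc]; linarith
      · have hi : i ∉ L := by simp [hL, h']
        rw [if_neg hi, sum_eq_zero fun r _ => gain_eq_zero_of_large r _ h']
        positivity
  refine (sum_le_sum fun i _ => hpt i).trans ?_
  rw [sum_add_distrib, ← mul_sum]
  refine add_le_add le_rfl ?_
  rw [← sum_filter, sum_const, nsmul_eq_mul]
  have hcard : (#{i | i ∈ L} : ℝ) ≤ 2 * 2 ^ D := by
    have : #{i | i ∈ L} ≤ 2 * 2 ^ D := by
      rw [filter_univ_mem]; exact card_leaf_actions_le D N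
    exact_mod_cast this
  calc (#{i | i ∈ L} : ℝ) * e ≤ 2 * 2 ^ D * e := by gcongr
    _ = _ := by rw [he]; push_cast; ring

theorem swapRegret_eq {N T : ℕ} (r : Coins N T) (x : Fin T → stdSimplex ℝ (Fin N)) :
    swapRegret x (treeReward N T r) =
      1 / (T : ℝ) * ∑ i, actionRegret r (fun t => (x t).1 i) i := rfl

/-- Lower bound for the average swap regret over all coins. -/
theorem one_le_mul_average_swapRegret {N T : ℕ} (hN : 2 ≤ N) (hT : 1 ≤ T)
    (x : Coins N T → Fin T → stdSimplex ℝ (Fin N)) (hx : Nonanticipating fun r t => (x r t).1) :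
    1 ≤ 6000 * (depthPos N T : ℝ) ^ 5 * Real.sqrt (batchSize N T) *
      ((∑ r, swapRegret (x r) (treeReward N T r)) / Fintype.card (Coins N T)) := by
  have hx0 : ∀ r t a, 0 ≤ (x r t).1 a := fun r t a => (x r t).2.1 a
  have hxs : ∀ r t, ∑ a, (x r t).1 a = 1 := fun r t => (x r t).2.2
  have hx1 : ∀ r t a, (x r t).1 a ≤ 1 := fun r t a => by
    rw [← hxs r t]
    exact single_le_sum (f := fun a => (x r t).1 a) (fun b _ => hx0 r t b) (mem_univ a)
  have hd1 := one_le_depthPos N T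
  have hB1 : (1 : ℝ) ≤ Real.sqrt (batchSize N T) := by
    rw [Real.one_le_sqrt]; exact_mod_cast batchSize_pos hN hT
  have hn : (0 : ℝ) < Fintype.card (Coins N T) := by exact_mod_cast Fintype.card_pos
  have hT0 : (0 : ℝ) < T := by exact_mod_cast hT
  have hTA : (T : ℝ) ≤ 2 * (batchSize N T * 2 ^ treeDepth N T : ℕ) := by
    exact_mod_cast le_two_mul_batchSize_mul hN hT
  set d : ℝ := Nat.cast (depthPos N T)
  set q := Real.sqrt (batchSize N T)
  set n : ℝ := Nat.cast (Fintype.card (Coins N T))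
  set A : ℝ := Nat.cast (batchSize N T * 2 ^ treeDepth N T)
  set K : ℝ := ∑ i, ∑ r, actionRegret r (fun t => (x r t).1 i) i with hKdef
  have hK0 : 0 ≤ K := sum_nonneg fun i _ => sum_nonneg fun r _ => actionRegret_nonneg _ _ _
  -- With this `θ` the error, multiplied by the 6 of `hroot`, is nA/(4d): half of the left side of
  -- `hroot`, into which it is absorbed.
  have hgain := sum_sum_gain_le hN hT hx hx0 hx1 (θ := 1 / (24 * d)) (by positivity)
  have hroot : 1 / (2 * d) * (n * A) ≤
      6 * K + 6 * ∑ i, ∑ r, gain r (fun t => (x r t).1 i) i := by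
    have h1 : n * A ≤ ∑ i, ∑ r, mass N (fun t => (x r t).1 i) 1 := by
      rw [sum_comm, ← nsmul_eq_mul]
      exact card_nsmul_le_sum _ _ _ fun r _ => le_sum_mass_root hN hT (hxs r)
    refine (mul_le_mul_of_nonneg_left h1 (by positivity)).trans ?_
    simp only [hKdef, mul_sum, ← sum_add_distrib]
    exact sum_le_sum fun i _ => sum_le_sum fun r _ =>
      mass_root_le hN hT r (fun t => hx0 r t i) i
  change _ ≤ (28 * d ^ 4 + 4 * q / (1 / (24 * d))) * K + 1 / (24 * d) * A * n at hgain
  have hdd : 4 * q / (1 / (24 * d)) = 96 * d * q := by field_simp; ring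
  rw [hdd] at hgain
  have h1 : n * A * (1 / d) ≤ 4 * (6 + 168 * d ^ 4 + 576 * d * q) * K := by
    have e1 : 1 / (2 * d) * (n * A) = n * A * (1 / d) / 2 := by field_simp
    have e2 : 1 / (24 * d) * A * n = n * A * (1 / d) / 24 := by field_simp
    rw [e1] at hroot; rw [e2] at hgain
    linarith
  have hd4 : d ≤ d ^ 4 := le_self_pow₀ hd1 (by norm_num)
  have h2 : 4 * (6 + 168 * d ^ 4 + 576 * d * q) ≤ 3000 * d ^ 4 * q := by
    have a1 : 1 ≤ d ^ 4 * q := one_le_mul_of_one_le_of_one_le (hd1.trans hd4) hB1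
    have a2 : d ^ 4 ≤ d ^ 4 * q := le_mul_of_one_le_right (by positivity) hB1
    have a3 : d * q ≤ d ^ 4 * q := by gcongr
    linarith
  have h3 : n * A ≤ 3000 * d ^ 5 * q * K := by
    have := h1.trans (mul_le_mul_of_nonneg_right h2 hK0)
    rw [mul_one_div, div_le_iff₀ (by positivity)] at this
    linarith
  have h4 : ∑ r, swapRegret (x r) (treeReward N T r) = K / T := by
    simp only [swapRegret_eq, ← mul_sum]
    rw [sum_comm, ← hKdef]; ring
  rw [h4, div_div, ← mul_div_assoc, le_div_iff₀ (by positivity), one_mul]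
  have := mul_le_mul_of_nonneg_right hTA hn.le
  linarith

/-! ### The `ℓ₁` norm of the rewards -/

/-- At most one action per depth is rewarded, and the sum of e/(2D) over e < D, plus 1 for the leaf,
is (D + 3)/4. -/
theorem sum_treeReward_le {N T : ℕ} (r : Coins N T) (t : Fin T) :
    ∑ a, treeReward N T r t a ≤ ((depthPos N T : ℝ) + 3) / 4 := by
  classical
  set D := treeDepth N T with hD
  set g : ℕ → ℝ := fun e => if e < D then (e : ℝ) / (2 * D) else 1 with hg
  have hg0 : ∀ e, 0 ≤ g e := fun e => by simp only [hg]; split_ifs <;> positivity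
  set s : Finset (Fin N) := {a : Fin N | treeReward N T r t a ≠ 0} with hs
  have hsub : ∀ a ∈ s, InSub N T (nodeOf a) t ∧
      treeReward N T r t a ≤ g (Nat.log 2 (nodeOf a)) ∧ Nat.log 2 (nodeOf a) < D + 1 ∧
      (IsDotted a ↔ if nodeOf a < 2 ^ D then InSub N T (2 * nodeOf a + 1) t ∧
        Switches r (nodeOf a) else r.2 t = true) := by
    intro a ha
    replace ha : treeReward N T r t a ≠ 0 := by simpa [hs] using ha
    rcases lt_or_ge (nodeOf a) (2 ^ D) with h | h
    · have hlog := log_lt_of_internal (nodeOf_ne_zero a) h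
      rw [treeReward_internal r t a h] at ha ⊢
      split_ifs at ha ⊢ with h'
      · exact ⟨h'.1, by simp only [hg, if_pos hlog]; exact le_rfl, by omega, h'.2⟩
      · exact absurd rfl ha
    · rw [treeReward_leaf r t a h] at ha ⊢
      split_ifs at ha ⊢ with h' h''
      · omega
      · have hlog := log_leaf h (h'.1.2.lt h'.1.1)
        exact ⟨h'.1, by simp [hg, hlog], by omega, h'.2⟩
      · exact absurd rfl ha
      · exact absurd rfl ha
  -- The depth fixes the node on the path, and the coins fix which of its two actions pays.
  have hinj : Set.InjOn (fun a : Fin N => Nat.log 2 (nodeOf a)) s := by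
    intro a ha b hb hab
    obtain ⟨ha1, -, -, ha2⟩ := hsub a ha
    obtain ⟨hb1, -, -, hb2⟩ := hsub b hb
    have hab' : Nat.log 2 (nodeOf a) = Nat.log 2 (nodeOf b) := hab
    have hnode : nodeOf a = nodeOf b := by
      have h1 := ha1.2
      have h2 := hb1.2
      rw [OnPath] at h1 h2
      rw [← h1, ← h2, hab']
    exact nodeOf_inj hnode (by rw [ha2, hb2, hnode])
  have hgauss : ∀ n : ℕ, ∑ e ∈ range n, (e : ℝ) = n * (n - 1) / 2 := fun n => by
    induction n with
    | zero => simp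
    | succ n ih => rw [sum_range_succ, ih]; push_cast; ring
  calc ∑ a, treeReward N T r t a = ∑ a ∈ s, treeReward N T r t a := (sum_filter_ne_zero _).symm
    _ ≤ ∑ a ∈ s, g (Nat.log 2 (nodeOf a)) := sum_le_sum fun a ha => (hsub a ha).2.1
    _ = ∑ e ∈ s.image fun a => Nat.log 2 (nodeOf a), g e := (sum_image hinj).symm
    _ ≤ ∑ e ∈ range (D + 1), g e := sum_le_sum_of_subset_of_nonneg
        (image_subset_iff.2 fun a ha => mem_range.2 (hsub a ha).2.2.1) fun e _ _ => hg0 e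
    _ = (∑ e ∈ range D, (e : ℝ)) / (2 * D) + 1 := by
        rw [sum_range_succ, sum_div]
        refine congrArg₂ _ (sum_congr rfl fun e he => ?_) (by simp [hg])
        simp [hg, mem_range.1 he]
    _ ≤ ((depthPos N T : ℝ) + 3) / 4 := by
        rw [hgauss, depthPos, ← hD]
        rcases Nat.eq_zero_or_pos D with h0 | h0
        · simp [h0]; norm_num
        · have h0' : (0 : ℝ) < D := by exact_mod_cast h0
          rw [max_eq_left h0]
          refine le_of_eq ?_
          field_simp; ring

theorem treeReward_mem_rewardCube {N T : ℕ} (r : Coins N T) (t : Fin T) :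
    treeReward N T r t ∈ rewardCube N :=
  fun a => ⟨treeReward_nonneg r t a, treeReward_le_one r t a⟩

theorem scaled_treeReward_mem_rewardL1Ball {N T : ℕ} (r : Coins N T) (t : Fin T) :
    (fun a => 4 / ((depthPos N T : ℝ) + 3) * treeReward N T r t a) ∈ rewardL1Ball N := by
  have hd := one_le_depthPos N T
  have hk : 0 ≤ 4 / ((depthPos N T : ℝ) + 3) := by positivity
  have hk1 : 4 / ((depthPos N T : ℝ) + 3) ≤ 1 := by rw [div_le_one (by positivity)]; linarith
  refine ⟨fun a => ⟨mul_nonneg hk (treeReward_nonneg r t a),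
    mul_le_one₀ hk1 (treeReward_nonneg r t a) (treeReward_le_one r t a)⟩, ?_⟩
  have : ∀ a, |4 / ((depthPos N T : ℝ) + 3) * treeReward N T r t a| =
      4 / ((depthPos N T : ℝ) + 3) * treeReward N T r t a := fun a =>
    abs_of_nonneg (mul_nonneg hk (treeReward_nonneg r t a))
  simp only [this, ← mul_sum]
  calc _ ≤ 4 / ((depthPos N T : ℝ) + 3) * (((depthPos N T : ℝ) + 3) / 4) :=
        mul_le_mul_of_nonneg_left (sum_treeReward_le r t) hk
    _ = 1 := by field_simp

/-! ### Expected swap regret against the tree adversary -/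

theorem tsum_map_uniformOfFintype {Ω α : Type*} [Fintype Ω] [Nonempty Ω] (U : Ω → α)
    (f : α → ℝ) :
    ∑' u, (((PMF.uniformOfFintype Ω).map U) u).toReal * f u =
      (∑ ω, f (U ω)) / Fintype.card Ω := by
  classical
  have h : ∀ u, (((PMF.uniformOfFintype Ω).map U) u).toReal * f u =
      ∑ ω, if u = U ω then (Fintype.card Ω : ℝ)⁻¹ * f (U ω) else 0 := by
    intro u
    rw [PMF.map_apply, tsum_fintype, ENNReal.toReal_sum (fun ω _ => by
      split_ifs <;> simp), sum_mul]
    refine sum_congr rfl fun ω _ => ?_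
    split_ifs with hu
    · simp [hu]
    · simp
  simp only [h]
  rw [Summable.tsum_finsetSum fun ω _ =>
    (hasSum_ite_eq (U ω) ((Fintype.card Ω : ℝ)⁻¹ * f (U ω))).summable]
  simp only [tsum_ite_eq, ← mul_sum]
  rw [div_eq_inv_mul]

theorem swapRegret_const_mul {N T : ℕ} (x : Fin T → stdSimplex ℝ (Fin N)) (u : Fin T → Fin N → ℝ)
    {k : ℝ} (hk : 0 ≤ k) : swapRegret x (fun t a => k * u t a) = k * swapRegret x u := by
  simp only [swapRegret]
  rw [mul_left_comm, mul_sum univ _ k]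
  congr 1
  refine sum_congr rfl fun i _ => ?_
  rw [Real.mul_iSup_of_nonneg hk]
  refine iSup_congr fun j => ?_
  rw [mul_sum]
  exact sum_congr rfl fun t _ => by ring

/-- Swap regret is homogeneous, and a learner that sees scaled rewards is still nonanticipating for
the unscaled ones, so the bound is just multiplied by `k`. -/
theorem le_expectedSwapRegret_scaled {N T : ℕ} (hN : 2 ≤ N) (hT : 1 ≤ T) {S : Set (Fin N → ℝ)}
    {k : ℝ} (hk : 0 ≤ k) (hS : ∀ r t, (fun a => k * treeReward N T r t a) ∈ S)
    (x : Learner N T S) :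
    k ≤ 6000 * (depthPos N T : ℝ) ^ 5 * Real.sqrt (batchSize N T) *
      expectedSwapRegret ((PMF.uniformOfFintype (Coins N T)).map
        fun r t => (⟨fun a => k * treeReward N T r t a, hS r t⟩ : S)) x := by
  rw [expectedSwapRegret, tsum_map_uniformOfFintype]
  have h := one_le_mul_average_swapRegret hN hT
    (fun r => x.play fun t => ⟨fun a => k * treeReward N T r t a, hS r t⟩) (by
      intro r r' t h
      simp only [Learner.play]
      congr 3
      funext s
      exact Subtype.ext (by simp only; rw [h ⟨s, s.2.trans t.2⟩ s.2]))
  simp only [swapRegret_const_mul _ _ hk, ← mul_sum, mul_div_assoc]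
  have := mul_le_mul_of_nonneg_left h hk
  linarith

theorem exists_adversary_rewardCube {N T : ℕ} (hN : 2 ≤ N) (hT : 1 ≤ T) :
    ∃ 𝒟 : PMF (Fin T → rewardCube N),
      𝒟.map (fun u t => (u t : Fin N → ℝ)) = treeAdversary N T ∧
      ∀ x : Learner N T (rewardCube N),
        1 / ((depthPos N T : ℝ) ^ 5 * Real.sqrt (batchSize N T)) ≤
          6000 * expectedSwapRegret 𝒟 x := by
  have hS : ∀ r t, (fun a => 1 * treeReward N T r t a) ∈ rewardCube N := fun r t => by
    simpa using treeReward_mem_rewardCube r t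
  refine ⟨(PMF.uniformOfFintype (Coins N T)).map fun r t => ⟨_, hS r t⟩, ?_, fun x => ?_⟩
  rotate_left
  · have h := le_expectedSwapRegret_scaled hN hT zero_le_one hS x
    have hd := one_le_depthPos N T
    have hB : 0 < Real.sqrt (batchSize N T) := by
      rw [Real.sqrt_pos]; exact_mod_cast batchSize_pos hN hT
    rw [div_le_iff₀ (by positivity)]
    linarith
  · rw [PMF.map_comp, treeAdversary]
    congr 1
    funext r t a
    simp

theorem exists_adversary_rewardL1Ball {N T : ℕ} (hN : 2 ≤ N) (hT : 1 ≤ T) :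
    ∃ 𝒟 : PMF (Fin T → rewardL1Ball N),
      𝒟.map (fun u t => (u t : Fin N → ℝ)) = scaledTreeAdversary N T ∧
      ∀ x : Learner N T (rewardL1Ball N),
        1 / ((depthPos N T : ℝ) ^ 6 * Real.sqrt (batchSize N T)) ≤
          6000 * expectedSwapRegret 𝒟 x := by
  have hd := one_le_depthPos N T
  refine ⟨(PMF.uniformOfFintype (Coins N T)).map
    fun r t => ⟨_, scaled_treeReward_mem_rewardL1Ball r t⟩, ?_, fun x => ?_⟩
  rotate_left
  · have h := le_expectedSwapRegret_scaled hN hT (by positivity)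
      scaled_treeReward_mem_rewardL1Ball x
    have hB : 0 < Real.sqrt (batchSize N T) := by
      rw [Real.sqrt_pos]; exact_mod_cast batchSize_pos hN hT
    rw [div_le_iff₀ (by positivity)]
    -- The scaling factor is at least 1/d, which costs one power of the depth.
    have h1 : 1 ≤ depthPos N T * (4 / ((depthPos N T : ℝ) + 3)) := by
      rw [← mul_div_assoc, one_le_div (by positivity)]; linarith
    refine h1.trans ((mul_le_mul_of_nonneg_left h (by positivity)).trans (le_of_eq ?_))
    ring
  · rw [PMF.map_comp, scaledTreeAdversary, treeAdversary, PMF.map_comp]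
    rfl

/-! ### Asymptotics -/

theorem depthPos_le_two_mul_log {N T n : ℕ} (hn : 2 ≤ n) (h : 2 ^ treeDepth N T ≤ n) :
    (depthPos N T : ℝ) ≤ 2 * Real.log n := by
  have h2 : 2 ^ depthPos N T ≤ n := by
    unfold depthPos
    rcases max_choice (treeDepth N T) 1 with h' | h' <;> rw [h'] <;> simpa
  have h3 : (depthPos N T : ℝ) * Real.log 2 ≤ Real.log n := by
    rw [← Real.log_pow]
    exact Real.log_le_log (by positivity) (by exact_mod_cast h2)
  have h4 : (1 / 2 : ℝ) ≤ Real.log 2 := by linarith [Real.log_two_gt_d9]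
  nlinarith [one_le_depthPos N T]

/-- The two cases are the two arguments of the minimum defining the depth: either T limits the tree
and 2^D > T/2, or the actions do and 8 · 2^D > N. -/
theorem batchSize_eq_one_or {N T : ℕ} (hN : 2 ≤ N) (hT : 1 ≤ T) :
    batchSize N T = 1 ∨ batchSize N T * N ≤ 8 * T := by
  rcases le_total T ((N + 2) / 4) with h | h
  · left
    have hD : treeDepth N T = Nat.log 2 T := by rw [treeDepth, min_eq_left h]
    have h1 := Nat.lt_pow_succ_log_self (b := 2) (by norm_num) T
    rw [← hD, pow_succ] at h1
    have h2 : batchSize N T < 2 := Nat.div_lt_of_lt_mul h1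
    have := batchSize_pos hN hT
    omega
  · right
    have hD : treeDepth N T = Nat.log 2 ((N + 2) / 4) := by rw [treeDepth, min_eq_right h]
    have h1 := Nat.lt_pow_succ_log_self (b := 2) (by norm_num) ((N + 2) / 4)
    rw [← hD, pow_succ] at h1
    calc batchSize N T * N ≤ batchSize N T * (8 * 2 ^ treeDepth N T) :=
          Nat.mul_le_mul_left _ (by omega)
      _ = 8 * (batchSize N T * 2 ^ treeDepth N T) := by ring
      _ ≤ 8 * T := Nat.mul_le_mul_left _ (batchSize_mul_le N T)

/-- The depth is at most twice either logarithm, whence 2^m; the 3 bounds the √8 that comes from B N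
≤ 8T. -/
theorem min_le_depthPos_pow {N T : ℕ} (hN : 2 ≤ N) (hT : 2 ≤ T) (m : ℕ) :
    min (1 / Real.log T ^ m) (Real.sqrt ((N : ℝ) / T) / Real.log N ^ m) ≤
      3 * 2 ^ m * (1 / ((depthPos N T : ℝ) ^ m * Real.sqrt (batchSize N T))) := by
  have hd := one_le_depthPos N T
  obtain ⟨hDT, hDN⟩ := two_pow_treeDepth_le hN (by omega : 1 ≤ T)
  have hlogT := depthPos_le_two_mul_log hT hDT
  have hlogN := depthPos_le_two_mul_log (N := N) (T := T) hN (by omega)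
  set d : ℝ := Nat.cast (depthPos N T)
  have key : ∀ l : ℝ, d ≤ 2 * l → 1 / l ^ m ≤ 2 ^ m * (1 / d ^ m) := fun l hl => by
    have h := pow_le_pow_left₀ (by linarith) hl m
    have hl0 : 0 < l := by linarith
    rw [mul_pow] at h
    rw [mul_one_div, div_le_div_iff₀ (by positivity) (by positivity)]; linarith
  have hd0 : 0 ≤ 2 ^ m * (1 / d ^ m) := by positivity
  rcases batchSize_eq_one_or hN (by omega : 1 ≤ T) with h | h
  · refine (min_le_left _ _).trans ((key _ hlogT).trans ?_)
    rw [h, Nat.cast_one, Real.sqrt_one, mul_one]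
    linarith
  · refine (min_le_right _ _).trans ?_
    have hB : (0 : ℝ) < batchSize N T := by exact_mod_cast batchSize_pos hN (by omega)
    have hT0 : (0 : ℝ) < T := by positivity
    have h' : (batchSize N T : ℝ) * N ≤ 8 * T := by exact_mod_cast h
    have hs : Real.sqrt ((N : ℝ) / T) ≤ 3 * (1 / Real.sqrt (batchSize N T)) := by
      rw [Real.sqrt_le_left (by positivity), mul_pow, div_pow, Real.sq_sqrt hB.le, one_pow, mul_one_div,
        div_le_div_iff₀ hT0 hB]
      linarith
    calc _ = Real.sqrt ((N : ℝ) / T) * (1 / Real.log N ^ m) := by ring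
      _ ≤ 3 * (1 / Real.sqrt (batchSize N T)) * (2 ^ m * (1 / d ^ m)) :=
          mul_le_mul hs (key _ hlogN) (by have : 0 < Real.log N := by linarith
                                          positivity) (by positivity)
      _ = _ := by field_simp

/-! ### Solving the bounds for the number of rounds -/

theorem le_of_rounds_le_exp {c ε : ℝ} {T : ℕ} (hc : 0 < c) (hc1 : c ≤ 1) (hε : 0 < ε) (hT : 2 ≤ T)
    (h : (T : ℝ) ≤ Real.exp (c * ε ^ (-(1 / 6) : ℝ))) : ε ≤ c * (1 / Real.log T ^ 6) := by
  have hT0 : (1 : ℝ) < T := by exact_mod_cast hT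
  have hlog0 := Real.log_pos hT0
  have hlog : Real.log T ≤ c * ε ^ (-(1 / 6) : ℝ) := by
    rwa [Real.log_le_iff_le_exp (by linarith)]
  have h6 := pow_le_pow_left₀ hlog0.le hlog 6
  have he : (ε ^ (-(1 / 6) : ℝ)) ^ 6 = ε⁻¹ := by
    rw [← Real.rpow_natCast, ← Real.rpow_mul hε.le, ← Real.rpow_neg_one]; norm_num
  have hc6 : c ^ 6 ≤ c := by simpa using pow_le_pow_of_le_one hc.le hc1 (by norm_num : 1 ≤ 6)
  rw [mul_pow, he, ← div_eq_mul_inv, le_div_iff₀ hε] at h6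
  rw [mul_one_div, le_div_iff₀ (by positivity)]
  linarith

theorem le_of_rounds_le_div {c ε : ℝ} {N T : ℕ} (hc : 0 < c) (hε : 0 < ε) (hN : 2 ≤ N)
    (hT : 1 ≤ T) (h : (T : ℝ) ≤ c ^ 2 * ((N : ℝ) / (Real.log N ^ 12 * ε ^ 2))) :
    ε ≤ c * (Real.sqrt ((N : ℝ) / T) / Real.log N ^ 6) := by
  have hN0 : (1 : ℝ) < N := by exact_mod_cast hN
  have hT0 : (0 : ℝ) < T := by exact_mod_cast hT
  have hlog0 := Real.log_pos hN0
  rw [← mul_div_assoc, le_div_iff₀ (by positivity)] at h ⊢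
  have h2 : ε * Real.log N ^ 6 / c ≤ Real.sqrt ((N : ℝ) / T) := by
    refine Real.le_sqrt_of_sq_le ?_
    rw [div_pow, div_le_div_iff₀ (by positivity) hT0]
    linarith
  rw [div_le_iff₀ hc] at h2
  linarith

theorem depthPos_one (N : ℕ) : depthPos N 1 = 1 := by
  have : treeDepth N 1 = 0 := Nat.log_of_lt (lt_of_le_of_lt (min_le_left _ _) (by norm_num))
  simp [depthPos, this]

theorem batchSize_one (N : ℕ) : batchSize N 1 = 1 := by
  have : treeDepth N 1 = 0 := Nat.log_of_lt (lt_of_le_of_lt (min_le_left _ _) (by norm_num))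
  simp [batchSize, this]

/-- For the single-round case: there log T = 0 and 1 / log T ^ 6 is 0 by convention, so the bound
must come from `c₁` being at most exp(-K), together with ε^(-1/6) ≤ 1/ε. -/
theorem le_of_one_le_exp {c ε K : ℝ} (hc : 0 < c) (hc1 : c ≤ 1) (hε : 0 < ε) (hε1 : ε < 1)
    (hK : 0 < K) (h : 1 ≤ Real.exp (-K) * Real.exp (c * ε ^ (-(1 / 6) : ℝ))) : ε ≤ 1 / K := by
  rw [← Real.exp_add, Real.one_le_exp_iff] at h
  have h1 : ε ^ (-(1 / 6) : ℝ) ≤ ε⁻¹ := by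
    rw [← Real.rpow_neg_one]
    exact Real.rpow_le_rpow_of_exponent_ge hε hε1.le (by norm_num)
  have h2 : 0 < ε⁻¹ := inv_pos.2 hε
  have h3 : K ≤ ε⁻¹ := by nlinarith [Real.rpow_pos_of_pos hε (-(1 / 6) : ℝ)]
  rw [one_div]
  exact (le_inv_comm₀ hK hε).1 h3

end SwapLowerBound
end

/-! ### The three lower bounds with their absolute constants -/

theorem theorem4p1 :
    -- rewards in `[0,1]^N`
    (∃ c : ℝ, 0 < c ∧ ∀ N T : ℕ, 2 ≤ N → 2 ≤ T →
      ∃ 𝒟 : PMF (Fin T → SwapLowerBound.rewardCube N),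
        𝒟.map (fun u t => (u t : Fin N → ℝ)) = SwapLowerBound.treeAdversary N T ∧
        ∀ x : SwapLowerBound.Learner N T (SwapLowerBound.rewardCube N),
          c * min (1 / Real.log T ^ 5) (Real.sqrt ((N : ℝ) / T) / Real.log N ^ 5) ≤
            SwapLowerBound.expectedSwapRegret 𝒟 x) ∧
    -- rewards in `[0,1]^N` with `ℓ₁` norm at most `1`
    (∃ c : ℝ, 0 < c ∧ ∀ N T : ℕ, 2 ≤ N → 2 ≤ T →
      ∃ 𝒟 : PMF (Fin T → SwapLowerBound.rewardL1Ball N),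
        𝒟.map (fun u t => (u t : Fin N → ℝ)) = SwapLowerBound.scaledTreeAdversary N T ∧
        ∀ x : SwapLowerBound.Learner N T (SwapLowerBound.rewardL1Ball N),
          c * min (1 / Real.log T ^ 6) (Real.sqrt ((N : ℝ) / T) / Real.log N ^ 6) ≤
            SwapLowerBound.expectedSwapRegret 𝒟 x) ∧
    -- the number of rounds needed for swap regret below `ε`
    (∃ c₁ c₂ : ℝ, 0 < c₁ ∧ 0 < c₂ ∧ ∀ (N T : ℕ) (ε : ℝ), 2 ≤ N → 1 ≤ T → 0 < ε → ε < 1 →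
      (T : ℝ) ≤ c₁ * min (Real.exp (c₂ * ε ^ (-(1 / 6) : ℝ)))
        ((N : ℝ) / (Real.log N ^ 12 * ε ^ 2)) →
      ∃ 𝒟 : PMF (Fin T → SwapLowerBound.rewardL1Ball N),
        ∀ x : SwapLowerBound.Learner N T (SwapLowerBound.rewardL1Ball N),
          ε ≤ SwapLowerBound.expectedSwapRegret 𝒟 x) := by
  -- Here 96 = 3 · 2^5 and 192 = 3 · 2^6 come from `min_le_depthPos_pow`. The square in `c₁` serves
  -- the bound in N, the factor exp(-6000) the case T = 1.
  refine ⟨⟨1 / (6000 * 96), by norm_num, fun N T hN hT => ?_⟩,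
    ⟨1 / (6000 * 192), by norm_num, fun N T hN hT => ?_⟩,
    min ((1 / (6000 * 192)) ^ 2) (Real.exp (-6000)), 1 / (6000 * 192),
    lt_min (by norm_num) (Real.exp_pos _), by norm_num, fun N T ε hN hT hε hε1 hTε => ?_⟩
  · obtain ⟨𝒟, h𝒟, h⟩ := SwapLowerBound.exists_adversary_rewardCube hN (by omega : 1 ≤ T)
    exact ⟨𝒟, h𝒟, fun x => by
      linarith [h x, SwapLowerBound.min_le_depthPos_pow hN hT 5]⟩
  · obtain ⟨𝒟, h𝒟, h⟩ := SwapLowerBound.exists_adversary_rewardL1Ball hN (by omega : 1 ≤ T)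
    exact ⟨𝒟, h𝒟, fun x => by
      linarith [h x, SwapLowerBound.min_le_depthPos_pow hN hT 6]⟩
  · obtain ⟨𝒟, -, h⟩ := SwapLowerBound.exists_adversary_rewardL1Ball hN hT
    refine ⟨𝒟, fun x => ?_⟩
    have hx := h x
    set c₁ : ℝ := min ((1 / (6000 * 192)) ^ 2) (Real.exp (-6000))
    have hc₁0 : 0 < c₁ := lt_min (by norm_num) (Real.exp_pos _)
    have hc₁ : c₁ ≤ (1 / (6000 * 192)) ^ 2 := min_le_left _ _
    have hc₁' : c₁ ≤ Real.exp (-6000) := min_le_right _ _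
    have hexp := hTε.trans (mul_le_mul_of_nonneg_left (min_le_left _ _) hc₁0.le)
    have hdiv := hTε.trans (mul_le_mul_of_nonneg_left (min_le_right _ _) hc₁0.le)
    -- For T = 1 depth parameter and batch size are both 1, so the regret is at least 1/6000
    -- directly.
    rcases hT.eq_or_lt with rfl | hT2
    · have h1 := SwapLowerBound.le_of_one_le_exp (c := 1 / (6000 * 192)) (by norm_num)
        (by norm_num) hε hε1 (by norm_num : (0 : ℝ) < 6000)
        (Nat.cast_one.symm.trans_le
          (hexp.trans (mul_le_mul_of_nonneg_right hc₁' (Real.exp_pos _).le)))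
      simp only [SwapLowerBound.depthPos_one, SwapLowerBound.batchSize_one, Nat.cast_one, one_pow,
        Real.sqrt_one, mul_one, div_one] at hx
      linarith
    · have h1 := SwapLowerBound.le_of_rounds_le_exp (c := 1 / (6000 * 192)) (by norm_num)
        (by norm_num) hε hT2
        (hexp.trans (mul_le_of_le_one_left (Real.exp_pos _).le (hc₁.trans (by norm_num))))
      have h2 := SwapLowerBound.le_of_rounds_le_div (c := 1 / (6000 * 192)) (by norm_num) hε hN hT
        (hdiv.trans (mul_le_mul_of_nonneg_right hc₁ (by positivity)))
      have h3 := le_min h1 h2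
      rw [← mul_min_of_nonneg _ _ (by norm_num)] at h3
      linarith [SwapLowerBound.min_le_depthPos_pow hN hT2 6]
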